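/- Lemma 3.4. Let $k\colon\mathbb N\to\mathbb N$ satisfy $k(n)\le\mathrm{polylog}(n)$, i.e. $k(n)=O((\log n)^c)$ for some constant $c$. For $x\in\{0,1\}^n$ let $|x|=x_1+\dots+x_n$, and let $\mathsf{Th}_{\ge k(n)}\colon\{0,1\}^n\to\{0,1\}$ be the threshold function, $\mathsf{Th}_{\ge k(n)}(x)=1$ if and only if $|x|\ge k(n)$. Then $\mathsf{Th}_{\ge k}=(\mathsf{Th}_{\ge k(n)})_{n}$ is in $\mathsf{EQAC}^0$. That is, there are a constant $d$ and a polynomial $p$ such that for every $n$ there are an integer $a\ge0$ and a quantum circuit $C$ on $n+a+1$ qubits, composed of arbitrary single-qubit gates and generalized Toffoli gates $|y_1,\dots,y_m\rangle|b\rangle\mapsto|y_1,\dots,y_m\rangle|b\oplus(y_1\wedge\dots\wedge y_m)\rangle$, such that $C$ has depth at most $d$ (it is a product of at most $d$ layers, each a product of gates on disjoint sets of qubits) and size at most $p(n)$ (total number of gates plus number of qubits), and, for every $x\in\{0,1\}^n$, measuring the last qubit of $C|x\rangle|0^a\rangle|0\rangle$ in the computational basis gives $\mathsf{Th}_{\ge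 k(n)}(x)$ with probability $1$. -/

import Mathlib

noncomputable section

/-- A vector of amplitudes on qubits labelled by `Q`: one complex amplitude for every computational
basis state, i.e. for every assignment of a bit to each qubit. -/
abbrev QState (Q : Type) : Type := (Q → Bool) → ℂ

/-- The computational basis state `|z⟩`. -/
def basisState {Q : Type} [Fintype Q] [DecidableEq Q] (z : Q → Bool) : QState Q :=
  fun y => if y = z then 1 else 0

/-- The gates of `QAC` circuits on qubits labelled by `Q`: arbitrary single-qubit unitaries, and
generalized Toffoli gates `|x⟩|b⟩ ↦ |x⟩|b ⊕ AND(x)⟩` with any number of control qubits.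
(With no control qubit the latter is the single-qubit NOT gate.) -/
inductive QACGate (Q : Type) : Type
  | single (q : Q) (U : Matrix.unitaryGroup Bool ℂ) : QACGate Q
  | toffoli (controls : Finset Q) (target : Q) (h : target ∉ controls) : QACGate Q

namespace QACGate

variable {Q : Type} [DecidableEq Q]

/-- The qubits that a gate operates on. -/
def support : QACGate Q → Finset Q
  | single q _ => {q}
  | toffoli controls target _ => insert target controls

/-- The action of a gate on amplitudes. For the Toffoli gate, the amplitude of `y` after the gate
is the amplitude, before it, of the preimage of `y` (the gate is an involution on basis states). -/
def apply : QACGate Q → QState Q → QState Q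
  | single q U, ψ => fun y =>
      ∑ b : Bool, (U : Matrix Bool Bool ℂ) (y q) b * ψ (Function.update y q b)
  | toffoli controls target _, ψ => fun y =>
      ψ (Function.update y target (xor (y target) (decide (∀ c ∈ controls, y c = true))))

end QACGate

/-- A layer: a product of gates operating on pairwise disjoint sets of qubits. -/
structure QACLayer (Q : Type) [DecidableEq Q] : Type where
  gates : List (QACGate Q)
  disjoint : gates.Pairwise fun g h => Disjoint g.support h.support

/-- The action of a layer: its gates are applied (the order is immaterial, by disjointness). -/
def QACLayer.apply {Q : Type} [DecidableEq Q] (L : QACLayer Q) (ψ : QState Q) : QState Q :=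
  L.gates.foldl (fun φ g => g.apply φ) ψ

/-- A `QAC` circuit `M_d ⋯ M_1`, given by the list `[M_1, …, M_d]` of its layers. -/
structure QACCircuit (Q : Type) [DecidableEq Q] : Type where
  layers : List (QACLayer Q)

namespace QACCircuit

/-- The depth: the number of layers. -/
def depth {Q : Type} [DecidableEq Q] (C : QACCircuit Q) : ℕ := C.layers.length

/-- The size: the total number of gates plus the number of qubits. -/
def size {Q : Type} [Fintype Q] [DecidableEq Q] (C : QACCircuit Q) : ℕ :=
  (C.layers.map fun L => L.gates.length).sum + Fintype.card Q

/-- The action of a circuit: the layers are applied one after the other, first layer first. -/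
def apply {Q : Type} [DecidableEq Q] (C : QACCircuit Q) (ψ : QState Q) : QState Q :=
  C.layers.foldl (fun φ L => L.apply φ) ψ

end QACCircuit

/-- The probability that measuring the qubit `q` of `ψ` in the computational basis gives `b`. -/
def measureProb {Q : Type} [Fintype Q] [DecidableEq Q] (ψ : QState Q) (q : Q) (b : Bool) : ℝ :=
  ∑ y : Q → Bool, if y q = b then ‖ψ y‖ ^ 2 else 0

/-- The qubits of a circuit with `n` input qubits, `a` ancillas and one output ("last") qubit. -/
abbrev Reg (n a : ℕ) : Type := Fin n ⊕ (Fin a ⊕ Unit)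

/-- The output qubit. -/
def outQubit (n a : ℕ) : Reg n a := Sum.inr (Sum.inr ())

/-- The initial assignment `x 0^a 0`. -/
def initBits {n : ℕ} (a : ℕ) (x : Fin n → Bool) : Reg n a → Bool :=
  Sum.elim x fun _ => false

/-- `C` decides `f` with `a` ancillas and error `ε`: for every `x`, the last qubit of
`C |x⟩|0^a⟩|0⟩` measures to `f x` with probability at least `1 - ε`. -/
def QACCircuit.Decides {n a : ℕ} (C : QACCircuit (Reg n a)) (f : (Fin n → Bool) → Bool) (ε : ℝ) :
    Prop :=
  ∀ x : Fin n → Bool,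
    1 - ε ≤ measureProb (C.apply (basisState (initBits a x))) (outQubit n a) (f x)

/-- `C` exactly decides `f`: it decides `f` with zero error. -/
def QACCircuit.ExactlyDecides {n a : ℕ} (C : QACCircuit (Reg n a)) (f : (Fin n → Bool) → Bool) :
    Prop :=
  C.Decides f 0

/-- `EQAC⁰`: the languages, given by their indicator functions on `{0,1}^n` for each `n`, that are
exactly decided by `QAC` circuits of constant depth and polynomial size. -/
def EQAC0 : Set ((n : ℕ) → (Fin n → Bool) → Bool) :=
  {f | ∃ (d : ℕ) (p : Polynomial ℕ), ∀ n : ℕ, ∃ (a : ℕ) (C : QACCircuit (Reg n a)),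
    C.depth ≤ d ∧ C.size ≤ p.eval n ∧ C.ExactlyDecides (f n)}

/-- The Hamming weight `|x|`. -/
def hammingWeight {n : ℕ} (x : Fin n → Bool) : ℕ :=
  (Finset.univ.filter fun i => x i = true).card

/-- The threshold function: `Th_{≥k}(x) = 1` iff `|x| ≥ k`. -/
def threshold (k n : ℕ) (x : Fin n → Bool) : Bool := decide (k ≤ hammingWeight x)

/-- `k(n) ≤ polylog(n)`: there is a constant `c` with `k(n) = O((log n)^c)`. -/
def IsPolylog (k : ℕ → ℕ) : Prop :=
  ∃ c : ℕ, (fun n : ℕ => (k n : ℝ)) =O[Filter.atTop] fun n : ℕ => Real.log n ^ c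

end

/-! A threshold `k` that is polylogarithmic in `n` is reduced to a threshold on polylogarithmically
many bits, and the latter is computed by exact quantum interference, with an exact fan-out gadget as
the only quantum resource beyond AND and OR.

Fan-out. Take `N` columns of `m` qubits, each in a state where `1^m` is overwhelmingly likely and
`0^m` has probability of order `2^(-m²)`, and compute the AND of every row. If all columns are `1^m`
the row ANDs are all 1; if some column is `0^m` they are all 0. With `N` about `2^(m²)` each case
has probability at least 1/4. Flag qubits lower both probabilities to exactly 1/4, and then a single
Grover iteration succeeds with certainty (`copySpec_of_prob`, `copySpec_fin`). For `m` about `√(log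
n)` the size is polynomial, and a tree of constant height `t` gives `m^t` copies, hence any
polylogarithmic number (`CopySpec.of_card_le`).

Small thresholds. Controlled on copies of one qubit in superposition, the inputs contribute phases
depending only on the Hamming weight; a Hadamard test then separates any two chosen weights exactly
(`computes_weightTest`). An OR over the second weight decides whether the weight differs from `j`,
and an AND over `j < k` gives the threshold.

Reduction. Hash the `n` inputs into `q` buckets, with `q` a polylogarithmic prime, take the OR of
each bucket, and test whether at least `k` buckets are hit. A collision can only lower the count, so
an OR over a family of hash functions is correct as soon as each `k`-set is injected by some member;
evaluations of low-degree polynomials over `ZMod q` form such a family (`exists_hash`).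

Exactness is tracked through supports: an output is certain when every basis state of nonzero
amplitude carries it, so garbage need not be erased except where branches have to interfere. -/

noncomputable section

set_option linter.unusedSectionVars false

open scoped ComplexConjugate

/-! ### Gates: linearity, inverses, commutation, and placement in a larger register. -/

namespace QACGate

variable {Q G : Type} [DecidableEq Q] [DecidableEq G]

theorem forall_mem_update_iff {c : Finset Q} {q : Q} (hq : q ∉ c) (y : Q → Bool) (b : Bool) :
    (∀ p ∈ c, Function.update y q b p = true) ↔ ∀ p ∈ c, y p = true := by
  refine forall₂_congr fun p hp => ?_
  rw [Function.update_of_ne]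
  rintro rfl
  exact hq hp

theorem involutive_toffoli {c : Finset Q} {t : Q} (ht : t ∉ c) : Function.Involutive
    fun y : Q → Bool => Function.update y t (xor (y t) (decide (∀ q ∈ c, y q = true))) := by
  intro y
  simp only [forall_mem_update_iff ht]
  simp

/-- The permutation of basis states that a Toffoli gate realizes. -/
def toffoliMap (c : Finset Q) (t : Q) (y : Q → Bool) : Q → Bool :=
  Function.update y t (xor (y t) (decide (∀ q ∈ c, y q = true)))

theorem toffoliMap_target {c : Finset Q} {t : Q} {y : Q → Bool} {b : Bool}
    (h : b = true ↔ ∀ q ∈ c, y q = true) : toffoliMap c t y t = xor (y t) b := by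
  rw [toffoliMap, Function.update_self, ← Bool.decide_coe b]
  simp only [h]

theorem toffoliMap_of_ne {c : Finset Q} {t q : Q} (h : q ≠ t) (y : Q → Bool) :
    toffoliMap c t y q = y q :=
  Function.update_of_ne h _ _

theorem apply_add (g : QACGate Q) (ψ φ : QState Q) : g.apply (ψ + φ) = g.apply ψ + g.apply φ := by
  cases g <;> (funext y; simp [apply, mul_add, Finset.sum_add_distrib])

theorem apply_smul (g : QACGate Q) (c : ℂ) (ψ : QState Q) : g.apply (c • ψ) = c • g.apply ψ := by
  cases g <;> (funext y; simp [apply, mul_add, mul_left_comm])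

/-- The inverse gate. -/
def inv : QACGate Q → QACGate Q
  | single q U => single q U⁻¹
  | toffoli c t h => toffoli c t h

@[simp] theorem inv_inv (g : QACGate Q) : g.inv.inv = g := by cases g <;> simp [inv]

@[simp] theorem support_inv (g : QACGate Q) : g.inv.support = g.support := by
  cases g <;> simp [inv, support]

theorem inv_apply_apply (g : QACGate Q) (ψ : QState Q) : g.inv.apply (g.apply ψ) = ψ := by
  cases g with
  | single q U =>
    funext y
    have h : ∀ a b, ∑ c, ((U⁻¹ : Matrix.unitaryGroup Bool ℂ) : Matrix Bool Bool ℂ) a c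
        * (U : Matrix Bool Bool ℂ) c b = if a = b then 1 else 0 := by
      intro a b
      have : ((U⁻¹ : Matrix.unitaryGroup Bool ℂ) : Matrix Bool Bool ℂ) * (U : Matrix Bool Bool ℂ)
          = 1 := by
        rw [← Submonoid.coe_mul, inv_mul_cancel, Submonoid.coe_one]
      rw [← Matrix.mul_apply, this, Matrix.one_apply]
    simp only [inv, apply, Function.update_self, Function.update_idem, Finset.mul_sum]
    rw [Finset.sum_comm]
    simp only [← mul_assoc, ← Finset.sum_mul, h]
    simp
  | toffoli c t ht =>
    funext y
    exact congrArg ψ (involutive_toffoli ht y)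

theorem comm (g h : QACGate Q) (hd : Disjoint g.support h.support) (ψ : QState Q) :
    g.apply (h.apply ψ) = h.apply (g.apply ψ) := by
  cases g with
  | single q U =>
    cases h with
    | single q' U' =>
      have hq : q ≠ q' := by simpa [support] using hd
      funext y
      simp only [apply, Fintype.sum_bool, Function.update_of_ne hq, Function.update_of_ne hq.symm,
        Function.update_comm hq]
      ring
    | toffoli c t ht =>
      simp only [support, Finset.disjoint_singleton_left, Finset.mem_insert, not_or] at hd
      funext y
      simp only [apply, Function.update_of_ne hd.1, Function.update_of_ne (Ne.symm hd.1),
        forall_mem_update_iff hd.2, Function.update_comm hd.1]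
  | toffoli c t ht =>
    cases h with
    | single q U =>
      simp only [support, Finset.disjoint_singleton_right, Finset.mem_insert, not_or] at hd
      funext y
      simp only [apply, Function.update_of_ne hd.1, Function.update_of_ne (Ne.symm hd.1),
        forall_mem_update_iff hd.2, Function.update_comm hd.1]
    | toffoli c' t' ht' =>
      simp only [support, Finset.disjoint_insert_left, Finset.disjoint_insert_right,
        Finset.mem_insert, not_or] at hd
      funext y
      simp only [apply, Function.update_of_ne hd.1.1, Function.update_of_ne (Ne.symm hd.1.1),
        forall_mem_update_iff hd.1.2, forall_mem_update_iff hd.2.1, Function.update_comm hd.1.1]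

/-- A gate on `G`, as a gate on a larger set of qubits. -/
def map (e : G ↪ Q) : QACGate G → QACGate Q
  | single q U => single (e q) U
  | toffoli c t h => toffoli (c.map e) (e t) (by simpa using h)

theorem support_map (e : G ↪ Q) (g : QACGate G) : (g.map e).support = g.support.map e := by
  cases g <;> simp [map, support]

theorem extend_update (e : G ↪ Q) (z : G → Bool) (y : Q → Bool) (q : G) (b : Bool) :
    Function.update (Function.extend e z y) (e q) b
      = Function.extend e (Function.update z q b) y := by
  funext p
  by_cases hp : ∃ a, e a = p
  · obtain ⟨a, rfl⟩ := hp
    rw [e.injective.extend_apply]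
    by_cases h : a = q
    · subst h; simp
    · rw [Function.update_of_ne h, Function.update_of_ne (fun h' => h (e.injective h')),
        e.injective.extend_apply]
  · rw [Function.extend_apply' _ _ _ hp, Function.update_of_ne, Function.extend_apply' _ _ _ hp]
    rintro rfl
    exact hp ⟨q, rfl⟩

/-- Once the bits outside the range of `e` are frozen to those of `y`, a state on `Q` becomes a
state on `G`, and an embedded gate acts on each such slice separately. -/
theorem map_apply_extend (e : G ↪ Q) (g : QACGate G) (ψ : QState Q) (y : Q → Bool) :
    (fun z => (g.map e).apply ψ (Function.extend e z y))
      = g.apply fun z => ψ (Function.extend e z y) := by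
  funext z
  cases g with
  | single q U => simp [map, apply, extend_update, e.injective.extend_apply]
  | toffoli c t h => simp [map, apply, extend_update, e.injective.extend_apply]

end QACGate

/-- The inner product of two states. -/
def innerProd {Q : Type} [Fintype Q] [DecidableEq Q] (ψ φ : QState Q) : ℂ :=
  ∑ y, conj (ψ y) * φ y

/-- The inverse gate is the adjoint. This is what makes circuits preserve inner products, hence
total probability. -/
theorem QACGate.innerProd_apply {Q : Type} [Fintype Q] [DecidableEq Q] (g : QACGate Q)
    (ψ φ : QState Q) : innerProd (g.apply ψ) φ = innerProd ψ (g.inv.apply φ) := by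
  cases g with
  | single q U =>
    simp only [innerProd, QACGate.apply, inv, map_sum, map_mul, Finset.sum_mul, Finset.mul_sum]
    rw [← Fintype.sum_prod_type', ← Fintype.sum_prod_type']
    -- The summation index is a pair of an assignment and a bit; exchanging that bit with the one at
    -- `q` matches the two double sums.
    have hinv : Function.Involutive
        (fun p : (Q → Bool) × Bool => (Function.update p.1 q p.2, p.1 q)) := by
      rintro ⟨y, b⟩; simp
    refine Fintype.sum_equiv hinv.toPerm _ _ ?_
    rintro ⟨y, b⟩
    simp [Function.Involutive.toPerm, Matrix.star_apply]
    ring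
  | toffoli c t ht =>
    simp only [innerProd, QACGate.apply, inv]
    refine Fintype.sum_equiv (involutive_toffoli ht).toPerm _ _ fun y => ?_
    exact congrArg (fun w => conj (ψ _) * φ w) (involutive_toffoli ht y).symm

/-! ### Layers and circuits: sequential, inverse and parallel composition. -/

namespace QACLayer

variable {Q G : Type} [DecidableEq Q] [DecidableEq G]

theorem apply_add (L : QACLayer Q) (ψ φ : QState Q) : L.apply (ψ + φ) = L.apply ψ + L.apply φ := by
  unfold apply
  induction L.gates generalizing ψ φ with
  | nil => rfl
  | cons g l ih => simp [QACGate.apply_add, ih]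

theorem apply_smul (L : QACLayer Q) (c : ℂ) (ψ : QState Q) : L.apply (c • ψ) = c • L.apply ψ := by
  unfold apply
  induction L.gates generalizing ψ with
  | nil => rfl
  | cons g l ih => simp [QACGate.apply_smul, ih]

/-- The inverse layer. -/
def inv (L : QACLayer Q) : QACLayer Q where
  gates := (L.gates.map QACGate.inv).reverse
  disjoint := by
    rw [List.pairwise_reverse, List.pairwise_map]
    exact L.disjoint.imp fun h => by simpa using h.symm

theorem inv_apply_apply (L : QACLayer Q) (ψ : QState Q) : L.inv.apply (L.apply ψ) = ψ := by
  unfold apply inv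
  simp only
  induction L.gates generalizing ψ with
  | nil => rfl
  | cons g l ih => simp [List.foldl_append, ih, QACGate.inv_apply_apply]

theorem inv_inv (L : QACLayer Q) : L.inv.inv = L := by
  cases L; simp [inv, Function.comp_def]

/-- A layer on `G`, as a layer on a larger set of qubits. -/
def map (e : G ↪ Q) (L : QACLayer G) : QACLayer Q where
  gates := L.gates.map (QACGate.map e)
  disjoint := by
    rw [List.pairwise_map]
    exact L.disjoint.imp fun h => by simpa [QACGate.support_map] using h

theorem map_apply_extend (e : G ↪ Q) (L : QACLayer G) (ψ : QState Q) (y : Q → Bool) :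
    (fun z => (L.map e).apply ψ (Function.extend e z y))
      = L.apply fun z => ψ (Function.extend e z y) := by
  unfold apply map
  simp only
  induction L.gates generalizing ψ with
  | nil => rfl
  | cons g l ih => simp [ih, QACGate.map_apply_extend]

theorem comm (L M : QACLayer Q)
    (h : ∀ g ∈ L.gates, ∀ g' ∈ M.gates, Disjoint g.support g'.support) (ψ : QState Q) :
    L.apply (M.apply ψ) = M.apply (L.apply ψ) := by
  have aux : ∀ (l : List (QACGate Q)) (g : QACGate Q),
      (∀ g' ∈ l, Disjoint g.support g'.support) → ∀ ψ : QState Q,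
      g.apply (l.foldl (fun φ g => g.apply φ) ψ) = l.foldl (fun φ g => g.apply φ) (g.apply ψ) := by
    intro l g
    induction l with
    | nil => intros; rfl
    | cons a l ih =>
      intro hl ψ
      simp only [List.foldl_cons]
      rw [ih (fun g' hg' => hl g' (List.mem_cons_of_mem _ hg')), QACGate.comm]
      exact hl a (List.mem_cons_self)
  unfold apply
  revert h
  induction L.gates generalizing ψ with
  | nil => intros; rfl
  | cons g l ih =>
    intro h
    simp only [List.foldl_cons]
    rw [aux _ g (h g List.mem_cons_self), ih]
    exact fun g hg => h g (List.mem_cons_of_mem _ hg)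

theorem innerProd_apply [Fintype Q] (L : QACLayer Q) (ψ φ : QState Q) :
    innerProd (L.apply ψ) φ = innerProd ψ (L.inv.apply φ) := by
  unfold apply inv
  simp only
  induction L.gates generalizing ψ with
  | nil => rfl
  | cons g l ih => simp [List.foldl_append, ih, QACGate.innerProd_apply]

end QACLayer

namespace QACCircuit

variable {Q G : Type} [DecidableEq Q] [DecidableEq G]

theorem apply_add (C : QACCircuit Q) (ψ φ : QState Q) :
    C.apply (ψ + φ) = C.apply ψ + C.apply φ := by
  unfold apply
  induction C.layers generalizing ψ φ with
  | nil => rfl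
  | cons g l ih => simp [QACLayer.apply_add, ih]

theorem apply_smul (C : QACCircuit Q) (c : ℂ) (ψ : QState Q) :
    C.apply (c • ψ) = c • C.apply ψ := by
  unfold apply
  induction C.layers generalizing ψ with
  | nil => rfl
  | cons g l ih => simp [QACLayer.apply_smul, ih]

/-- The action of a circuit, as a linear map. -/
def toLin (C : QACCircuit Q) : QState Q →ₗ[ℂ] QState Q where
  toFun := C.apply
  map_add' := C.apply_add
  map_smul' := C.apply_smul

theorem apply_sum {κ : Type*} (C : QACCircuit Q) (s : Finset κ) (f : κ → QState Q) :
    C.apply (∑ i ∈ s, f i) = ∑ i ∈ s, C.apply (f i) :=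
  map_sum C.toLin f s

theorem apply_sub (C : QACCircuit Q) (ψ φ : QState Q) :
    C.apply (ψ - φ) = C.apply ψ - C.apply φ :=
  map_sub C.toLin ψ φ

/-- The total number of gates. -/
def gateCount (C : QACCircuit Q) : ℕ := (C.layers.map fun L => L.gates.length).sum

/-- Sequential composition: `C` first. -/
def seq (C D : QACCircuit Q) : QACCircuit Q := ⟨C.layers ++ D.layers⟩

@[simp] theorem seq_apply (C D : QACCircuit Q) (ψ : QState Q) :
    (C.seq D).apply ψ = D.apply (C.apply ψ) := by
  simp [seq, apply]

@[simp] theorem depth_seq (C D : QACCircuit Q) : (C.seq D).depth = C.depth + D.depth := by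
  simp [seq, depth]

@[simp] theorem gateCount_seq (C D : QACCircuit Q) :
    (C.seq D).gateCount = C.gateCount + D.gateCount := by
  simp [seq, gateCount]

/-- The inverse circuit. -/
def inv (C : QACCircuit Q) : QACCircuit Q := ⟨(C.layers.map QACLayer.inv).reverse⟩

theorem inv_apply_apply (C : QACCircuit Q) (ψ : QState Q) : C.inv.apply (C.apply ψ) = ψ := by
  unfold apply inv
  simp only
  induction C.layers generalizing ψ with
  | nil => rfl
  | cons g l ih => simp [List.foldl_append, ih, QACLayer.inv_apply_apply]

@[simp] theorem inv_inv (C : QACCircuit Q) : C.inv.inv = C := by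
  cases C; simp [inv, Function.comp_def, QACLayer.inv_inv]

theorem apply_inv_apply (C : QACCircuit Q) (ψ : QState Q) : C.apply (C.inv.apply ψ) = ψ := by
  simpa using C.inv.inv_apply_apply ψ

@[simp] theorem depth_inv (C : QACCircuit Q) : C.inv.depth = C.depth := by simp [inv, depth]

@[simp] theorem gateCount_inv (C : QACCircuit Q) : C.inv.gateCount = C.gateCount := by
  simp [inv, gateCount, QACLayer.inv, Function.comp_def, List.map_reverse, List.sum_reverse]

theorem innerProd_apply [Fintype Q] (C : QACCircuit Q) (ψ φ : QState Q) :
    innerProd (C.apply ψ) φ = innerProd ψ (C.inv.apply φ) := by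
  unfold apply inv
  simp only
  induction C.layers generalizing ψ with
  | nil => rfl
  | cons g l ih => simp [List.foldl_append, ih, QACLayer.innerProd_apply]

theorem innerProd_apply_apply [Fintype Q] (C : QACCircuit Q) (ψ φ : QState Q) :
    innerProd (C.apply ψ) (C.apply φ) = innerProd ψ φ := by
  rw [innerProd_apply, inv_apply_apply]

/-- A circuit on `G`, as a circuit on a larger set of qubits. -/
def map (e : G ↪ Q) (C : QACCircuit G) : QACCircuit Q := ⟨C.layers.map (QACLayer.map e)⟩

@[simp] theorem depth_map (e : G ↪ Q) (C : QACCircuit G) : (C.map e).depth = C.depth := by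
  simp [map, depth]

@[simp] theorem gateCount_map (e : G ↪ Q) (C : QACCircuit G) :
    (C.map e).gateCount = C.gateCount := by
  simp [map, gateCount, QACLayer.map, Function.comp_def]

theorem map_apply_extend (e : G ↪ Q) (C : QACCircuit G) (ψ : QState Q) (y : Q → Bool) :
    (fun z => (C.map e).apply ψ (Function.extend e z y))
      = C.apply fun z => ψ (Function.extend e z y) := by
  unfold apply map
  simp only
  induction C.layers generalizing ψ with
  | nil => rfl
  | cons g l ih => simp [ih, QACLayer.map_apply_extend]

theorem extend_comp_self (e : G ↪ Q) (y : Q → Bool) : Function.extend e (y ∘ e) y = y := by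
  funext q
  by_cases h : ∃ a, e a = q
  · obtain ⟨a, rfl⟩ := h
    simp [e.injective.extend_apply]
  · simp [Function.extend_apply' _ _ _ h]

theorem map_apply (e : G ↪ Q) (C : QACCircuit G) (ψ : QState Q) (y : Q → Bool) :
    (C.map e).apply ψ y = C.apply (fun z => ψ (Function.extend e z y)) (y ∘ e) := by
  rw [← map_apply_extend]
  simp only [extend_comp_self]

/-- All gates of the circuit operate within `S`. -/
def SuppIn (C : QACCircuit Q) (S : Set Q) : Prop :=
  ∀ L ∈ C.layers, ∀ g ∈ L.gates, (g.support : Set Q) ⊆ S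

theorem suppIn_map (e : G ↪ Q) (C : QACCircuit G) : (C.map e).SuppIn (Set.range e) := by
  intro L hL g hg
  simp only [map, List.mem_map] at hL
  obtain ⟨L, -, rfl⟩ := hL
  simp only [QACLayer.map, List.mem_map] at hg
  obtain ⟨g, -, rfl⟩ := hg
  simp [QACGate.support_map]

/-- The empty circuit. -/
def nil : QACCircuit Q := ⟨[]⟩

@[simp] theorem nil_apply (ψ : QState Q) : (nil : QACCircuit Q).apply ψ = ψ := rfl

/-- The circuit with a single gate. -/
def ofGate (g : QACGate Q) : QACCircuit Q := ⟨[⟨[g], by simp⟩]⟩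

@[simp] theorem ofGate_apply (g : QACGate Q) (ψ : QState Q) :
    (ofGate g).apply ψ = g.apply ψ := rfl

@[simp] theorem depth_ofGate (g : QACGate Q) : (ofGate g).depth = 1 := rfl

@[simp] theorem gateCount_ofGate (g : QACGate Q) : (ofGate g).gateCount = 1 := rfl

theorem layer_comm (C : QACCircuit Q) (L : QACLayer Q) {S T : Set Q} (hC : C.SuppIn S)
    (hL : ∀ g ∈ L.gates, (g.support : Set Q) ⊆ T) (hST : Disjoint S T) (ψ : QState Q) :
    C.apply (L.apply ψ) = L.apply (C.apply ψ) := by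
  obtain ⟨Cl⟩ := C
  simp only [apply]
  induction Cl generalizing ψ with
  | nil => rfl
  | cons M Cl ih =>
    simp only [List.foldl_cons]
    rw [QACLayer.comm M L, ih]
    · exact fun M hM => hC M (List.mem_cons_of_mem _ hM)
    · intro g hg g' hg'
      rw [← Finset.disjoint_coe]
      exact hST.mono (hC M List.mem_cons_self g hg) (hL g' hg')

/-- Circuits on disjoint sets of qubits can be run in parallel. -/
theorem exists_par (C D : QACCircuit Q) {S T : Set Q} (hC : C.SuppIn S) (hD : D.SuppIn T)
    (hST : Disjoint S T) :
    ∃ E : QACCircuit Q, E.depth = max C.depth D.depth ∧ E.gateCount = C.gateCount + D.gateCount ∧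
      E.SuppIn (S ∪ T) ∧ ∀ ψ, E.apply ψ = D.apply (C.apply ψ) := by
  obtain ⟨Cl⟩ := C
  obtain ⟨Dl⟩ := D
  induction Cl generalizing Dl with
  | nil =>
    refine ⟨⟨Dl⟩, by simp [depth], by simp [gateCount], ?_, fun ψ => rfl⟩
    exact fun L hL g hg => (hD L hL g hg).trans Set.subset_union_right
  | cons L Cl ih =>
    cases Dl with
    | nil =>
      refine ⟨⟨L :: Cl⟩, by simp [depth], by simp [gateCount], ?_, fun ψ => rfl⟩
      exact fun L hL g hg => (hC L hL g hg).trans Set.subset_union_left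
    | cons M Dl =>
      have hC' : (⟨Cl⟩ : QACCircuit Q).SuppIn S := fun M hM => hC M (List.mem_cons_of_mem _ hM)
      have hL : ∀ g ∈ L.gates, (g.support : Set Q) ⊆ S := hC L List.mem_cons_self
      have hM : ∀ g ∈ M.gates, (g.support : Set Q) ⊆ T := hD M List.mem_cons_self
      obtain ⟨⟨El⟩, h1, h2, h3, h4⟩ := ih hC' Dl fun M hM => hD M (List.mem_cons_of_mem _ hM)
      refine ⟨⟨⟨L.gates ++ M.gates, ?_⟩ :: El⟩, ?_, ?_, ?_, ?_⟩
      · rw [List.pairwise_append]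
        refine ⟨L.disjoint, M.disjoint, fun g hg g' hg' => ?_⟩
        rw [← Finset.disjoint_coe]
        exact hST.mono (hL g hg) (hM g' hg')
      · simp only [depth, List.length_cons] at h1 ⊢
        omega
      · simp only [gateCount, List.map_cons, List.sum_cons, List.length_append] at h2 ⊢
        omega
      · intro L' hL' g hg
        rcases List.mem_cons.1 hL' with rfl | hL'
        · rcases List.mem_append.1 hg with hg | hg
          · exact (hL g hg).trans Set.subset_union_left
          · exact (hM g hg).trans Set.subset_union_right
        · exact h3 L' hL' g hg
      · intro ψ
        -- Merging `M` into the first layer requires moving it past the remaining layers of `C`,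
        -- which act on disjoint qubits.
        have h5 := layer_comm ⟨Cl⟩ M hC' hM hST (L.apply ψ)
        simp only [apply, List.foldl_cons] at h4 h5 ⊢
        rw [h4]
        simp only [QACLayer.apply] at h5 ⊢
        rw [List.foldl_append, h5]

end QACCircuit

/-! ### Matrix elements, supports of output states, and parallel families. -/

theorem basisState_self {Q : Type} [Fintype Q] [DecidableEq Q] (z : Q → Bool) :
    basisState z z = 1 := by simp [basisState]

theorem basisState_ne {Q : Type} [Fintype Q] [DecidableEq Q] {z y : Q → Bool} (h : y ≠ z) :
    basisState z y = 0 := by simp [basisState, h]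

theorem sum_smul_basisState {Q : Type} [Fintype Q] [DecidableEq Q] (ψ : QState Q) :
    ∑ z, ψ z • basisState z = ψ := by
  funext y
  simp [Finset.sum_apply, basisState]

namespace QACCircuit

/-- The basis state `y` has a nonzero amplitude after `C` is applied to the basis state `z`. -/
def Reaches {Q : Type} [Fintype Q] [DecidableEq Q] (C : QACCircuit Q) (z y : Q → Bool) : Prop :=
  C.apply (basisState z) y ≠ 0

theorem apply_eq_sum {Q : Type} [Fintype Q] [DecidableEq Q] (C : QACCircuit Q) (ψ : QState Q)
    (y : Q → Bool) : C.apply ψ y = ∑ z, ψ z * C.apply (basisState z) y := by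
  conv_lhs => rw [← sum_smul_basisState ψ, apply_sum]
  simp [Finset.sum_apply, apply_smul]

theorem exists_of_apply_ne_zero {Q : Type} [Fintype Q] [DecidableEq Q] {C : QACCircuit Q}
    {ψ : QState Q} {y : Q → Bool} (h : C.apply ψ y ≠ 0) : ∃ z, ψ z ≠ 0 ∧ C.Reaches z y := by
  rw [apply_eq_sum] at h
  obtain ⟨z, -, hz⟩ := Finset.exists_ne_zero_of_sum_ne_zero h
  exact ⟨z, left_ne_zero_of_mul hz, right_ne_zero_of_mul hz⟩

/-- Only this direction holds: paths through different intermediate states may cancel. It suffices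
for propagating facts that hold on the whole support. -/
theorem Reaches.seq {Q : Type} [Fintype Q] [DecidableEq Q] {C D : QACCircuit Q} {z y : Q → Bool}
    (h : (C.seq D).Reaches z y) : ∃ w, C.Reaches z w ∧ D.Reaches w y := by
  unfold Reaches at h
  rw [seq_apply] at h
  exact exists_of_apply_ne_zero h

section Family

variable {ι : Type} [Fintype ι] [DecidableEq ι] {Q : Type} [Fintype Q] [DecidableEq Q]
  {G : ι → Type} [∀ i, Fintype (G i)] [∀ i, DecidableEq (G i)]

theorem extend_comp_of_disjoint {G H Q : Type} (e : G ↪ Q) (f : H ↪ Q)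
    (h : Disjoint (Set.range e) (Set.range f)) (w : G → Bool) (y : Q → Bool) :
    Function.extend e w y ∘ f = y ∘ f := by
  funext b
  refine Function.extend_apply' _ _ _ ?_
  rintro ⟨a, ha⟩
  exact Set.disjoint_left.1 h ⟨a, ha⟩ ⟨b, rfl⟩

theorem exists_family_finset (e : ∀ i, G i ↪ Q)
    (he : Pairwise fun i j => Disjoint (Set.range (e i)) (Set.range (e j)))
    (C : ∀ i, QACCircuit (G i)) {d : ℕ} (hd : ∀ i, (C i).depth ≤ d) (s : Finset ι) :
    ∃ E : QACCircuit Q, E.depth ≤ d ∧ E.gateCount = ∑ i ∈ s, (C i).gateCount ∧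
      E.SuppIn (⋃ i ∈ s, Set.range (e i)) ∧ ∀ z y, E.apply (basisState z) y =
        (∏ i ∈ s, (C i).apply (basisState (z ∘ e i)) (y ∘ e i)) *
          if ∀ q, (∀ i ∈ s, q ∉ Set.range (e i)) → y q = z q then 1 else 0 := by
  classical
  induction s using Finset.induction_on with
  | empty =>
    refine ⟨nil, by simp [nil, depth], by simp [nil, gateCount], ?_, fun z y => ?_⟩
    · intro L hL; simp [nil] at hL
    · simp [basisState, funext_iff]
  | insert a s ha ih =>
    obtain ⟨E, h1, h2, h3, h4⟩ := ih
    have hdis : Disjoint (⋃ i ∈ s, Set.range (e i)) (Set.range (e a)) := by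
      simp only [Set.disjoint_iUnion_left]
      exact fun i hi => he (fun h => ha (h ▸ hi))
    obtain ⟨F, f1, f2, f3, f4⟩ := exists_par E ((C a).map (e a)) h3 (suppIn_map _ _) hdis
    refine ⟨F, ?_, ?_, ?_, fun z y => ?_⟩
    · rw [f1]; simp [h1, hd]
    · rw [f2, h2, Finset.sum_insert ha, gateCount_map, add_comm]
    · rwa [Finset.set_biUnion_insert, Set.union_comm]
    · rw [f4, map_apply, Finset.prod_insert ha]
      -- The circuits already combined leave the block of `a` untouched, so on that block the state
      -- is a scalar multiple of a basis state and linearity applies.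
      have key : (fun w => E.apply (basisState z) (Function.extend (e a) w y)) =
          ((∏ i ∈ s, (C i).apply (basisState (z ∘ e i)) (y ∘ e i)) *
            if ∀ q, (∀ i ∈ insert a s, q ∉ Set.range (e i)) → y q = z q then 1 else 0) •
            basisState (z ∘ e a) := by
        funext w
        rw [h4, Pi.smul_apply, smul_eq_mul, mul_assoc]
        congr 1
        · refine Finset.prod_congr rfl fun i hi => ?_
          rw [extend_comp_of_disjoint]
          exact he fun h => ha (h ▸ hi)
        · have : (∀ q, (∀ i ∈ s, q ∉ Set.range (e i)) → Function.extend (e a) w y q = z q) ↔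
              ((∀ q, (∀ i ∈ insert a s, q ∉ Set.range (e i)) → y q = z q) ∧ w = z ∘ e a) := by
            constructor
            · intro h
              refine ⟨fun q hq => ?_, funext fun g => ?_⟩
              · rw [← h q fun i hi => hq i (Finset.mem_insert_of_mem hi),
                  Function.extend_apply' _ _ _ (hq a (Finset.mem_insert_self _ _))]
              · have := h (e a g) fun i hi hr => Set.disjoint_left.1 hdis
                  (Set.mem_iUnion₂.2 ⟨i, hi, hr⟩) ⟨g, rfl⟩
                rwa [(e a).injective.extend_apply] at this
            · rintro ⟨h, rfl⟩ q hq
              by_cases hqa : ∃ g, e a g = q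
              · obtain ⟨g, rfl⟩ := hqa
                rw [(e a).injective.extend_apply]; rfl
              · rw [Function.extend_apply' _ _ _ hqa]
                refine h q fun i hi => ?_
                rcases Finset.mem_insert.1 hi with rfl | hi
                · exact hqa
                · exact hq i hi
          simp only [this, basisState, ite_zero_mul_ite_zero, mul_one]
      rw [key, apply_smul, Pi.smul_apply, smul_eq_mul]
      ring

/-- A family of circuits on pairwise disjoint sets of qubits can be run in parallel; the matrix
elements of the result are products. -/
theorem exists_family (f : ∀ i, G i → Q) (hf : ∀ i, Function.Injective (f i))
    (hdis : ∀ i j a b, f i a = f j b → i = j)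
    (C : ∀ i, QACCircuit (G i)) {d : ℕ} (hd : ∀ i, (C i).depth ≤ d) :
    ∃ E : QACCircuit Q, E.depth ≤ d ∧ E.gateCount = ∑ i, (C i).gateCount ∧
      ∀ z y, E.apply (basisState z) y =
        (∏ i, (C i).apply (basisState (z ∘ f i)) (y ∘ f i)) *
          if ∀ q, (∀ i a, f i a ≠ q) → y q = z q then 1 else 0 := by
  obtain ⟨E, h1, h2, -, h4⟩ := exists_family_finset (fun i => ⟨f i, hf i⟩) (fun i j h => by
      refine Set.disjoint_left.2 ?_
      rintro _ ⟨a, rfl⟩ ⟨b, hb⟩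
      exact h (hdis _ _ _ _ hb).symm) C hd Finset.univ
  refine ⟨E, h1, h2, fun z y => ?_⟩
  rw [h4]
  simp only [Finset.mem_univ, true_imp_iff, Set.mem_range, not_exists]
  rfl

theorem exists_family_reaches (f : ∀ i, G i → Q) (hf : ∀ i, Function.Injective (f i))
    (hdis : ∀ i j a b, f i a = f j b → i = j)
    (C : ∀ i, QACCircuit (G i)) {d : ℕ} (hd : ∀ i, (C i).depth ≤ d) :
    ∃ E : QACCircuit Q, E.depth ≤ d ∧ E.gateCount = ∑ i, (C i).gateCount ∧
      ∀ z y, E.Reaches z y → (∀ i, (C i).Reaches (z ∘ f i) (y ∘ f i)) ∧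
        ∀ q, (∀ i a, f i a ≠ q) → y q = z q := by
  obtain ⟨E, h1, h2, h3⟩ := exists_family f hf hdis C hd
  refine ⟨E, h1, h2, fun z y h => ?_⟩
  rw [Reaches, h3] at h
  refine ⟨fun i => Finset.prod_ne_zero_iff.1 (left_ne_zero_of_mul h) i (Finset.mem_univ i), ?_⟩
  by_contra hn
  exact right_ne_zero_of_mul h (if_neg hn)

end Family

theorem map_apply_basisState {Q G : Type} [Fintype Q] [DecidableEq Q] [Fintype G] [DecidableEq G]
    (e : G ↪ Q) (C : QACCircuit G) (z y : Q → Bool) :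
    (C.map e).apply (basisState z) y = C.apply (basisState (z ∘ e)) (y ∘ e) *
      if ∀ q, q ∉ Set.range e → y q = z q then 1 else 0 := by
  rw [map_apply]
  have key : (fun w => basisState z (Function.extend e w y)) =
      (if ∀ q, q ∉ Set.range e → y q = z q then (1 : ℂ) else 0) • basisState (z ∘ e) := by
    funext w
    have : Function.extend e w y = z ↔ (∀ q, q ∉ Set.range e → y q = z q) ∧ w = z ∘ e := by
      constructor
      · rintro rfl
        exact ⟨fun q hq => (Function.extend_apply' _ _ _ hq).symm,
          (Function.extend_comp e.injective _ _).symm⟩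
      · rintro ⟨h, rfl⟩
        funext q
        by_cases hq : ∃ g, e g = q
        · obtain ⟨g, rfl⟩ := hq
          rw [e.injective.extend_apply]; rfl
        · rw [Function.extend_apply' _ _ _ hq, h q hq]
    simp only [basisState, this, Pi.smul_apply, smul_eq_mul, ite_zero_mul_ite_zero, mul_one]
  rw [key, apply_smul, Pi.smul_apply, smul_eq_mul, mul_comm]

theorem Reaches.map {Q G : Type} [Fintype Q] [DecidableEq Q] [Fintype G] [DecidableEq G]
    {e : G ↪ Q} {C : QACCircuit G} {z y : Q → Bool} (h : (C.map e).Reaches z y) :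
    C.Reaches (z ∘ e) (y ∘ e) ∧ ∀ q, q ∉ Set.range e → y q = z q := by
  rw [Reaches, map_apply_basisState] at h
  refine ⟨left_ne_zero_of_mul h, ?_⟩
  by_contra hn
  exact right_ne_zero_of_mul h (if_neg hn)

/-- The probabilities of the outcomes add up to one. -/
theorem sum_norm_sq_apply_basisState {Q : Type} [Fintype Q] [DecidableEq Q] (C : QACCircuit Q)
    (z : Q → Bool) : ∑ y, ‖C.apply (basisState z) y‖ ^ 2 = 1 := by
  have h := C.innerProd_apply_apply (basisState z) (basisState z)
  have h1 : innerProd (basisState z) (basisState z) = 1 := by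
    simp [innerProd, basisState]
  rw [h1] at h
  simp only [innerProd, Complex.conj_mul'] at h
  exact_mod_cast h

theorem measureProb_eq_one {Q : Type} [Fintype Q] [DecidableEq Q] (C : QACCircuit Q)
    (z : Q → Bool) (q : Q) (b : Bool) (h : ∀ y, C.Reaches z y → y q = b) :
    measureProb (C.apply (basisState z)) q b = 1 := by
  rw [← C.sum_norm_sq_apply_basisState z]
  refine Finset.sum_congr rfl fun y _ => ?_
  split_ifs with hy
  · rfl
  · have : C.apply (basisState z) y = 0 := by
      by_contra hn
      exact hy (h y hn)
    simp [this]

theorem size_eq {Q : Type} [Fintype Q] [DecidableEq Q] (C : QACCircuit Q) :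
    C.size = C.gateCount + Fintype.card Q := rfl

end QACCircuit

/-! ### Elementary circuits: single-qubit layers, sign flips and reflections. -/

/-- The real symmetric unitary `[[a, b], [b, -a]]`. -/
def symUnitary (a b : ℝ) (h : a ^ 2 + b ^ 2 = 1) : Matrix.unitaryGroup Bool ℂ :=
  ⟨Matrix.of fun i j => if i = j then (if i then -(a : ℂ) else a) else b, by
    have h' : (a : ℂ) * a + b * b = 1 := by
      have : a * a + b * b = 1 := by linarith [sq a, sq b]
      exact_mod_cast this
    have h'' : (b : ℂ) * b + a * a = 1 := by rw [add_comm, h']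
    rw [Matrix.mem_unitaryGroup_iff]
    ext i j
    cases i <;> cases j <;> simp [Matrix.mul_apply, Matrix.star_apply, h', h''] <;> ring⟩

/-- The NOT gate. -/
def notUnitary : Matrix.unitaryGroup Bool ℂ := symUnitary 0 1 (by norm_num)

/-- The Hadamard gate. -/
def hadamard : Matrix.unitaryGroup Bool ℂ :=
  symUnitary (√2)⁻¹ (√2)⁻¹ (by rw [inv_pow, Real.sq_sqrt (by norm_num)]; norm_num)

theorem inv_sqrt_two_mul_self : ((√2 : ℝ) : ℂ)⁻¹ * ((√2 : ℝ) : ℂ)⁻¹ = 1 / 2 := by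
  rw [← mul_inv]
  have : ((√2 : ℝ) : ℂ) * (√2 : ℝ) = 2 := by
    exact_mod_cast Real.mul_self_sqrt (by norm_num)
  rw [this]; norm_num

namespace QACCircuit

theorem single_apply_basisState (U : Matrix.unitaryGroup Bool ℂ) (z y : Unit → Bool) :
    (ofGate (QACGate.single () U)).apply (basisState z) y =
      (U : Matrix Bool Bool ℂ) (y ()) (z ()) := by
  have : ∀ b, Function.update y () b = z ↔ b = z () := by
    intro b
    rw [funext_iff]
    simp only [Function.update_self, Unique.forall_iff, PUnit.default_eq_unit]
  simp [QACGate.apply, basisState, this]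

variable {Q : Type} [Fintype Q] [DecidableEq Q]

/-- A layer with a single-qubit gate on each qubit. -/
theorem exists_singleLayer (U : Q → Matrix.unitaryGroup Bool ℂ) :
    ∃ E : QACCircuit Q, E.depth ≤ 1 ∧ E.gateCount = Fintype.card Q ∧
      ∀ z y, E.apply (basisState z) y = ∏ q, (U q : Matrix Bool Bool ℂ) (y q) (z q) := by
  obtain ⟨E, h1, h2, h3⟩ := exists_family (G := fun _ : Q => Unit) (fun q _ => q)
    (fun _ _ _ _ => rfl) (fun _ _ _ _ h => h)
    (fun q => ofGate (QACGate.single () (U q))) (d := 1) (fun _ => le_rfl)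
  refine ⟨E, h1, by simpa using h2, fun z y => ?_⟩
  rw [h3]
  simp only [single_apply_basisState, Function.comp_apply]
  rw [if_pos, mul_one]
  intro q hq
  exact absurd rfl (hq q ())

theorem exists_notLayer (s : Q → Bool) :
    ∃ E : QACCircuit Q, E.depth ≤ 1 ∧ E.gateCount = Fintype.card Q ∧
      ∀ z, E.apply (basisState z) = basisState fun q => xor (z q) (s q) := by
  obtain ⟨E, h1, h2, h3⟩ := exists_singleLayer fun q => if s q then notUnitary else 1
  refine ⟨E, h1, h2, fun z => ?_⟩
  funext y
  have : ∀ q, ((if s q then notUnitary else 1 : Matrix.unitaryGroup Bool ℂ) :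
      Matrix Bool Bool ℂ) (y q) (z q) = if y q = xor (z q) (s q) then 1 else 0 := by
    intro q
    cases s q <;> cases y q <;> cases z q <;> simp [notUnitary, symUnitary]
  rw [h3]
  simp only [this, basisState, funext_iff]
  rw [Fintype.prod_ite_zero]
  simp

/-- A Toffoli gate targeting any qubit `p`, conjugated by Hadamards on `p`, is the multiply
controlled Z gate. -/
theorem exists_flip_all [Nonempty Q] :
    ∃ E : QACCircuit Q, E.depth ≤ 3 ∧ E.gateCount = 3 ∧
      ∀ ψ y, E.apply ψ y = if ∀ q, y q = true then -ψ y else ψ y := by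
  obtain ⟨p⟩ := ‹Nonempty Q›
  have hp : p ∉ Finset.univ.erase p := by simp
  refine ⟨((ofGate (.single p hadamard)).seq (ofGate (.toffoli (Finset.univ.erase p) p hp))).seq
    (ofGate (.single p hadamard)), le_rfl, rfl, fun ψ y => ?_⟩
  have hs := inv_sqrt_two_mul_self
  have hall : (∀ q, y q = true) ↔ y p = true ∧ ∀ q ∈ Finset.univ.erase p, y q = true := by
    refine ⟨fun h => ⟨h p, fun q _ => h q⟩, fun h q => ?_⟩
    by_cases hq : q = p
    · rw [hq, h.1]
    · exact h.2 q (by simp [hq])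
  have e1 : y p = true → Function.update y p true = y := fun h => by rw [← h]; simp
  have e2 : y p = false → Function.update y p false = y := fun h => by rw [← h]; simp
  simp only [seq_apply, ofGate_apply, QACGate.apply, hall, QACGate.forall_mem_update_iff hp,
    Function.update_self, Function.update_idem, Fintype.sum_bool, hadamard, symUnitary]
  by_cases hc : ∀ q ∈ Finset.univ.erase p, y q = true
  · simp only [eq_true hc]
    cases hy : y p
    · have := e2 hy
      simp [this]
      linear_combination (2 * ψ y) * hs
    · have := e1 hy
      simp [this]
      linear_combination (-2 * ψ y) * hs
  · simp only [eq_false hc]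
    cases hy : y p
    · have := e2 hy
      simp [this]
      linear_combination (2 * ψ y) * hs
    · have := e1 hy
      simp [this]
      linear_combination (2 * ψ y) * hs

/-- The reflection about the state prepared by `W` from the all-ones basis state. -/
theorem exists_reflection [Nonempty Q] (W : QACCircuit Q) :
    ∃ E : QACCircuit Q, E.depth ≤ 2 * W.depth + 3 ∧ E.gateCount = 2 * W.gateCount + 3 ∧
      ∀ ψ, E.apply ψ = ψ - (2 * innerProd (W.apply (basisState fun _ => true)) ψ) •
        W.apply (basisState fun _ => true) := by
  obtain ⟨F, h1, h2, h3⟩ := exists_flip_all (Q := Q)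
  -- Conjugation by `W` carries the sign flip of the all-ones state to that of the state which `W`
  -- prepares from it.
  refine ⟨(W.inv.seq F).seq W, by simp; omega, by simp; omega, fun ψ => ?_⟩
  have : F.apply (W.inv.apply ψ) = W.inv.apply ψ -
      (2 * innerProd (W.apply (basisState fun _ => true)) ψ) • basisState fun _ => true := by
    rw [innerProd_apply]
    funext y
    rw [h3]
    by_cases hy : y = fun _ => true
    · subst hy
      simp [basisState, innerProd]
      ring
    · have hy' : ¬ ∀ q, y q = true := fun h => hy (funext h)
      simp [hy', basisState, hy]
  rw [seq_apply, seq_apply, this, apply_sub, apply_inv_apply, apply_smul]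

/-- The sign flip of a single basis state. -/
theorem exists_flip [Nonempty Q] (p : Q → Bool) :
    ∃ E : QACCircuit Q, E.depth ≤ 5 ∧ E.gateCount = 2 * Fintype.card Q + 3 ∧
      ∀ ψ y, E.apply ψ y = if y = p then -ψ y else ψ y := by
  obtain ⟨W, w1, w2, w3⟩ := exists_notLayer fun q => !(p q)
  obtain ⟨E, h1, h2, h3⟩ := exists_reflection W
  refine ⟨E, by omega, by rw [h2, w2], fun ψ y => ?_⟩
  rw [h3, w3]
  by_cases hy : y = p
  · subst hy
    simp [basisState, innerProd]
    ring
  · simp [basisState, hy]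

end QACCircuit

/-! ### Copying a bit by exact amplitude amplification. -/

/-- `b ↦ b^M` can be computed with garbage, in depth `d` with `s` gates and qubits. -/
def CopySpec (M : Type) (d s : ℕ) : Prop :=
  ∃ (A : Type) (_ : Fintype A) (_ : DecidableEq A) (out : M ↪ A) (C : QACCircuit (Option A)),
    C.depth ≤ d ∧ C.gateCount + Fintype.card A ≤ s ∧
      ∀ b y, C.Reaches (fun q => q.elim b fun _ => false) y →
        y none = b ∧ ∀ r, y (some (out r)) = b

namespace QACCircuit

/-- The state `|b⟩ ⊗ χ`. -/
def consState {A : Type} (b : Bool) (χ : QState A) : QState (Option A) :=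
  fun y => if y none = b then χ (fun a => y (some a)) else 0

theorem map_some_apply_consState {A : Type} [Fintype A] [DecidableEq A] (D : QACCircuit A)
    (b : Bool) (χ : QState A) :
    (D.map Function.Embedding.some).apply (consState b χ) = consState b (D.apply χ) := by
  funext y
  rw [map_apply]
  have h1 : ∀ w : A → Bool, Function.extend Function.Embedding.some w y none = y none := by
    intro w
    exact Function.extend_apply' _ _ _ (by simp)
  have h2 : ∀ w : A → Bool, (fun a => Function.extend Function.Embedding.some w y (some a)) = w :=
    fun w => funext fun a => Function.Embedding.some.injective.extend_apply _ _ _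
  simp only [consState, h1, h2]
  split_ifs
  · rfl
  · have : (fun _ : A → Bool => (0 : ℂ)) = (0 : ℂ) • fun _ => 0 := by
      funext; simp
    rw [this, apply_smul, zero_smul]
    rfl

theorem basisState_eq_consState {A : Type} [Fintype A] [DecidableEq A] (b : Bool) :
    basisState (fun q : Option A => q.elim b fun _ => false) =
      consState b (basisState fun _ => false) := by
  funext y
  simp [basisState, consState, funext_iff, Option.forall, ite_and]

/-- A flag set with probability `1 / (4p)`, which is at most 1 by the hypothesis, lowers a success
probability `p` to exactly 1/4. -/
theorem exists_norm_sq_rotation {p : ℝ} (h0 : 1 / 4 ≤ p) : ∃ U : Matrix.unitaryGroup Bool ℂ,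
    p * ‖(U : Matrix Bool Bool ℂ) true false‖ ^ 2 = 1 / 4 ∧
    ‖(U : Matrix Bool Bool ℂ) true false‖ ^ 2 + ‖(U : Matrix Bool Bool ℂ) false false‖ ^ 2 = 1 := by
  have hp : 0 < p := by linarith
  have hr : 1 / (4 * p) ≤ 1 := by rw [div_le_one (by linarith)]; linarith
  have hr0 : 0 ≤ 1 / (4 * p) := by positivity
  refine ⟨symUnitary √(1 - 1 / (4 * p)) √(1 / (4 * p)) ?_, ?_, ?_⟩
  · rw [Real.sq_sqrt (by linarith), Real.sq_sqrt hr0]; ring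
  · simp only [symUnitary, Matrix.of_apply, Bool.true_eq_false, if_false, Complex.norm_real, Real.norm_eq_abs,
      sq_abs]
    rw [Real.sq_sqrt hr0]
    field_simp
  · simp only [symUnitary, Matrix.of_apply, Bool.true_eq_false, Bool.false_eq_true, if_false, if_true,
      Complex.norm_real, Real.norm_eq_abs, sq_abs]
    rw [Real.sq_sqrt (sub_nonneg.2 hr), Real.sq_sqrt hr0]; ring

/-- If a circuit sets all of the qubits `o r` to `β` with probability at least `1 / 4`, for both
values of `β`, then exact amplitude amplification gives a copying circuit. -/
theorem copySpec_of_prob {M R : Type} [Fintype M] [Fintype R] [DecidableEq R] [DecidableEq M]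
    (o : M ↪ R) (A : QACCircuit R)
    (hA : ∀ β : Bool, 1 / 4 ≤ ∑ y : R → Bool, if ∀ r, y (o r) = β then
      ‖A.apply (basisState fun _ => false) y‖ ^ 2 else 0) :
    CopySpec M (3 * A.depth + 18)
      (3 * A.gateCount + 4 * Fintype.card M + 3 * Fintype.card R + 100) := by
  -- There are two flag qubits, indexed by the value `β` to be copied, since the two success
  -- probabilities may need different corrections. The good event for `β` is that all outputs equal
  -- `β` and the flag of `β` is set.
  choose U hU hU' using fun β => exists_norm_sq_rotation (hA β)
  -- the amplitudes of the qubits that adjust the probabilities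
  obtain ⟨V, v1, v2, v3⟩ := exists_singleLayer U
  set A1 : QACCircuit (R ⊕ Bool) := (A.map ⟨Sum.inl, Sum.inl_injective⟩).seq
    (V.map ⟨Sum.inr, Sum.inr_injective⟩) with hA1
  set φ : QState (R ⊕ Bool) := A1.apply (basisState fun _ => false) with hφ
  have hφ_apply : ∀ u w, φ (Sum.elim u w) = A.apply (basisState fun _ => false) u *
      ∏ γ, (U γ : Matrix Bool Bool ℂ) (w γ) false := by
    intro u w
    rw [hφ, hA1, seq_apply, map_apply]
    have h1 : ∀ z : Bool → Bool, Function.extend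
        (⟨Sum.inr, Sum.inr_injective⟩ : Bool ↪ R ⊕ Bool) z (Sum.elim u w) = Sum.elim u z := by
      intro z
      funext q
      rcases q with q | q
      · exact Function.extend_apply' _ _ _ (by simp)
      · exact Sum.inr_injective.extend_apply _ _ _
    have h2 : (fun z : Bool → Bool => (A.map ⟨Sum.inl, Sum.inl_injective⟩).apply
        (basisState fun _ => false) (Sum.elim u z)) =
        (A.apply (basisState fun _ => false) u) • basisState fun _ : Bool => false := by
      funext z
      rw [map_apply_basisState]
      simp [basisState, funext_iff, Function.comp_def]
    simp only [h1]
    rw [h2, apply_smul, Pi.smul_apply, smul_eq_mul, v3]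
    rfl
  have hprob : ∀ β, ∑ y : R ⊕ Bool → Bool,
      (if (∀ r, y (Sum.inl (o r)) = β) ∧ y (Sum.inr β) = true then ‖φ y‖ ^ 2 else 0) = 1 / 4 := by
    intro β
    rw [← (Equiv.sumArrowEquivProdArrow R Bool Bool).symm.sum_comp, Fintype.sum_prod_type,
      ← hU β, Finset.sum_mul]
    refine Finset.sum_congr rfl fun u _ => ?_
    change ∑ w : Bool → Bool, (if (∀ r, u (o r) = β) ∧ w β = true then
      ‖φ (Sum.elim u w)‖ ^ 2 else 0) = _
    by_cases hu : ∀ r, u (o r) = β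
    · rw [← (Equiv.boolArrowEquivProd Bool).symm.sum_comp, Fintype.sum_prod_type]
      have h0 := hU' false
      have h1 := hU' true
      cases β
      · simp [hu, hφ_apply, mul_pow]
        linear_combination (‖A.apply (basisState fun _ => false) u‖ ^ 2 *
          ‖(U false : Matrix Bool Bool ℂ) true false‖ ^ 2) * h1
      · simp [hu, hφ_apply, mul_pow]
        linear_combination (‖A.apply (basisState fun _ => false) u‖ ^ 2 *
          ‖(U true : Matrix Bool Bool ℂ) true false‖ ^ 2) * h0
    · simp [hu]
  -- Reflections are built from the all-ones state, whereas `A1` starts from all zeros; the NOT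
  -- layer bridges the two.
  obtain ⟨X, x1, x2, x3⟩ := exists_notLayer fun _ : R ⊕ Bool => true
  obtain ⟨E, e1, e2, e3⟩ := exists_reflection (X.seq A1)
  simp only [seq_apply, x3, Bool.xor_self] at e3
  rw [← hφ] at e3
  have hFinj : ∀ β : Bool, Function.Injective (fun q : Option (Option M) =>
      (q.elim none fun q => some (q.elim (Sum.inr β) fun r => Sum.inl (o r)) :
        Option (R ⊕ Bool))) := by
    rintro β (_ | _ | r) (_ | _ | r') <;> simp
  choose F f1 f2 f3 using fun β : Bool => exists_flip (Q := Option (Option M))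
    fun q => q.elim β fun q => q.elim true fun _ => β
  have hF : ∀ (β b : Bool) χ, ((F β).map ⟨_, hFinj β⟩).apply (consState b χ) =
      if b = β then consState b fun y =>
        if (∀ r, y (Sum.inl (o r)) = β) ∧ y (Sum.inr β) = true then -χ y else χ y
      else consState b χ := by
    intro β b χ
    have hp : ∀ y : Option (R ⊕ Bool) → Bool, (y ∘ (⟨_, hFinj β⟩ : Option (Option M) ↪ _) =
        fun q => q.elim β fun q => q.elim true fun _ => β) ↔
        y none = β ∧ (∀ r, y (some (Sum.inl (o r))) = β) ∧ y (some (Sum.inr β)) = true := by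
      intro y
      simp [funext_iff, Option.forall, and_comm]
    funext y
    rw [map_apply, f3, extend_comp_self]
    simp only [hp]
    by_cases hb : b = β
    · subst hb
      by_cases hy : y none = b <;> simp [consState, hy]
    · by_cases hy : y none = β
      · simp [consState, hb, hy, Ne.symm hb]
      · simp [hb, hy]
  -- Preparation and reflection ignore the input bit. Only the two sign flips read it, and the one
  -- for the wrong value acts trivially.
  refine ⟨R ⊕ Bool, inferInstance, inferInstance, o.trans ⟨Sum.inl, Sum.inl_injective⟩,
    (((A1.map .some).seq ((F false).map ⟨_, hFinj false⟩)).seq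
      ((F true).map ⟨_, hFinj true⟩)).seq (E.map .some), ?_, ?_, ?_⟩
  · have := f1 true
    have := f1 false
    simp only [depth_seq, depth_map, hA1] at e1 ⊢
    omega
  · have := f2 true
    have := f2 false
    simp only [gateCount_seq, gateCount_map, hA1, Fintype.card_option, Fintype.card_sum,
      Fintype.card_bool] at *
    omega
  · intro b y hy
    -- The good part of `φ` has squared norm 1/4, so its angle is `π/6` and one Grover iteration
    -- turns it to `π/2`. Concretely, the flipped state has inner product `1 - 2/4 = 1/2` with `φ`,
    -- so the reflection subtracts exactly `φ` and leaves `-2` times the good part.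
    have key : E.apply (fun y => if (∀ r, y (Sum.inl (o r)) = b) ∧ y (Sum.inr b) = true
        then -φ y else φ y) = fun y => if (∀ r, y (Sum.inl (o r)) = b) ∧ y (Sum.inr b) = true
        then -2 * φ y else 0 := by
      have hin : innerProd φ (fun y => if (∀ r, y (Sum.inl (o r)) = b) ∧ y (Sum.inr b) = true
          then -φ y else φ y) = 1 / 2 := by
        have h1 := A1.sum_norm_sq_apply_basisState fun _ => false
        rw [← hφ] at h1
        have h2 : ∑ y, (‖φ y‖ ^ 2 - 2 * if (∀ r, y (Sum.inl (o r)) = b) ∧ y (Sum.inr b) = true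
            then ‖φ y‖ ^ 2 else 0) = 1 / 2 := by
          rw [Finset.sum_sub_distrib, ← Finset.mul_sum, h1, hprob b]
          norm_num
        have h3 : ((∑ y, (‖φ y‖ ^ 2 - 2 * if (∀ r, y (Sum.inl (o r)) = b) ∧ y (Sum.inr b) = true
            then ‖φ y‖ ^ 2 else 0) : ℝ) : ℂ) = 1 / 2 := by
          rw [h2]; norm_num
        rw [← h3, innerProd, Complex.ofReal_sum]
        refine Finset.sum_congr rfl fun y _ => ?_
        split_ifs
        · push_cast
          rw [mul_neg, Complex.conj_mul']
          ring
        · push_cast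
          rw [Complex.conj_mul']
          ring
      rw [e3, hin]
      funext y
      simp only [Pi.sub_apply, Pi.smul_apply, smul_eq_mul]
      split_ifs <;> ring
    rw [Reaches, basisState_eq_consState] at hy
    simp only [seq_apply, map_some_apply_consState, ← hφ, hF] at hy
    have hy' : consState b (fun y => if (∀ r, y (Sum.inl (o r)) = b) ∧ y (Sum.inr b) = true
        then -2 * φ y else 0) y ≠ 0 := by
      rw [← key]
      cases b <;> simpa [hF, map_some_apply_consState] using hy
    simp only [consState] at hy'
    by_cases h1 : y none = b
    · rw [if_pos h1] at hy'
      refine ⟨h1, ?_⟩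
      by_contra hn
      exact hy' (if_neg fun h => hn h.1)
    · simp [h1] at hy'

end QACCircuit

/-! ### Copying with constant probability: columns, grids and row conjunctions. -/

namespace QACCircuit

/-- A circuit for a column: from `|0⟩`, the outcome `1^m` is much more likely than `0^m`, and all
other outcomes are unlikely. -/
theorem exists_column {m : ℕ} (hm : 0 < m) {ε : ℝ} (h0 : 0 ≤ ε) (h1 : ε ≤ 1) :
    ∃ C : QACCircuit (Fin m), C.depth ≤ 6 ∧ C.gateCount = 3 * m + 3 ∧
      ‖C.apply (basisState fun _ => false) fun _ => true‖ ^ 2 = (1 - 2 * ε ^ m) ^ 2 ∧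
      ‖C.apply (basisState fun _ => false) fun _ => false‖ ^ 2 = 4 * ε ^ m * (1 - ε) ^ m := by
  have : Nonempty (Fin m) := ⟨⟨0, hm⟩⟩
  have hε : √ε ^ 2 = ε := Real.sq_sqrt h0
  have hε' : √(1 - ε) ^ 2 = 1 - ε := Real.sq_sqrt (by linarith)
  obtain ⟨X, x1, x2, x3⟩ := exists_notLayer fun _ : Fin m => true
  obtain ⟨W, w1, w2, w3⟩ := exists_singleLayer fun _ : Fin m =>
    symUnitary √ε √(1 - ε) (by rw [hε, hε']; ring)
  obtain ⟨E, e1, e2, e3⟩ := exists_reflection W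
  have ht : W.apply (basisState fun _ => true) (fun _ => true) = (((-√ε) ^ m : ℝ) : ℂ) := by
    rw [w3]; simp [symUnitary]
  have hf : W.apply (basisState fun _ => true) (fun _ => false) = ((√(1 - ε) ^ m : ℝ) : ℂ) := by
    rw [w3]; simp [symUnitary]
  have hin : innerProd (W.apply (basisState fun _ => true)) (basisState fun _ => true) =
      (((-√ε) ^ m : ℝ) : ℂ) := by
    have : innerProd (W.apply (basisState fun _ => true)) (basisState fun _ => true) =
        conj (W.apply (basisState fun _ => true) fun _ => true) := by
      simp [innerProd, basisState]
    rw [this, ht, Complex.conj_ofReal]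
  have hsq : (-√ε) ^ m * (-√ε) ^ m = ε ^ m := by
    rw [← mul_pow, neg_mul_neg, ← sq, hε]
  have hsq' : √(1 - ε) ^ m * √(1 - ε) ^ m = (1 - ε) ^ m := by
    rw [← mul_pow, ← sq, hε']
  -- Reflecting `1^m` about a product state `w` gives `1^m - 2⟨w, 1^m⟩w`. The overlap is `±ε^(m/2)`,
  -- so the result stays close to `1^m`, with a small component on `0^m`.
  refine ⟨X.seq E, ?_, ?_, ?_, ?_⟩
  · rw [depth_seq]; omega
  · rw [gateCount_seq, x2, e2, w2, Fintype.card_fin]; ring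
  · rw [seq_apply, x3, e3, Pi.sub_apply, Pi.smul_apply, smul_eq_mul]
    simp only [Bool.false_xor, hin, ht, basisState_self]
    rw [mul_assoc, ← Complex.ofReal_mul, hsq]
    have : (1 : ℂ) - 2 * ((ε ^ m : ℝ) : ℂ) = ((1 - 2 * ε ^ m : ℝ) : ℂ) := by push_cast; ring
    rw [this, Complex.norm_real, Real.norm_eq_abs, sq_abs]
  · rw [seq_apply, x3, e3, Pi.sub_apply, Pi.smul_apply, smul_eq_mul]
    have hne : (fun _ : Fin m => false) ≠ fun _ => true := fun h => by
      simpa using congrFun h ⟨0, hm⟩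
    simp only [Bool.false_xor, hin, hf, basisState_ne hne]
    rw [mul_assoc, ← Complex.ofReal_mul]
    have : (0 : ℂ) - 2 * (((-√ε) ^ m * √(1 - ε) ^ m : ℝ) : ℂ) =
        ((-2 * ((-√ε) ^ m * √(1 - ε) ^ m) : ℝ) : ℂ) := by push_cast; ring
    rw [this, Complex.norm_real, Real.norm_eq_abs, sq_abs, ← hsq, ← hsq']
    ring

theorem toffoli_apply_basisState {Q : Type} [Fintype Q] [DecidableEq Q] {c : Finset Q} {t : Q}
    (ht : t ∉ c) (z : Q → Bool) : (ofGate (.toffoli c t ht)).apply (basisState z) =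
      basisState (QACGate.toffoliMap c t z) := by
  funext y
  have h : Function.Involutive (QACGate.toffoliMap c t) := QACGate.involutive_toffoli ht
  exact if_congr (h.eq_iff (x := y) (y := z)) rfl rfl

/-- A grid of `N` columns in the states `χ`, with the conjunction of each row computed. -/
theorem exists_grid {m N d : ℕ} (D : QACCircuit (Fin m)) (hd : D.depth ≤ d) :
    ∃ A : QACCircuit ((Fin N × Fin m) ⊕ Fin m), A.depth ≤ d + 1 ∧
      A.gateCount = N * D.gateCount + m ∧ ∀ c : Fin N × Fin m → Bool,
        A.apply (basisState fun _ => false) (Sum.elim c fun r => decide (∀ j, c (j, r) = true)) =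
          ∏ j, D.apply (basisState fun _ => false) fun r => c (j, r) := by
  obtain ⟨E, e1, e2, e3⟩ := exists_family (Q := (Fin N × Fin m) ⊕ Fin m) (G := fun _ : Fin N => Fin m)
    (fun j r => Sum.inl (j, r)) (fun j r r' h => by simpa using h)
    (fun i j a b h => by simp at h; exact h.1) (fun _ => D) (fun _ => hd)
  obtain ⟨F, f1, f2, f3⟩ := exists_family (Q := (Fin N × Fin m) ⊕ Fin m)
    (G := fun _ : Fin m => Option (Fin N))
    (fun r q => q.elim (Sum.inr r) fun j => Sum.inl (j, r))
    (fun r => by rintro (_ | i) (_ | j) <;> simp)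
    (fun i j => by rintro (_ | a) (_ | b) <;> simp)
    (fun _ => ofGate (.toffoli (Finset.univ.map .some) none (by simp))) (d := 1) (fun _ => le_rfl)
  refine ⟨E.seq F, by rw [depth_seq]; omega, ?_, fun c => ?_⟩
  · rw [gateCount_seq, e2, f2]; simp
  · have hF : ∀ c', F.apply (basisState (Sum.elim c' fun _ => false)) =
        basisState (Sum.elim c' fun r => decide (∀ j, c' (j, r) = true)) := by
      intro c'
      funext y
      rw [f3, if_pos, mul_one]
      · simp only [toffoli_apply_basisState]
        simp only [basisState]
        rw [Fintype.prod_ite_zero]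
        simp only [Finset.prod_const_one]
        congr 1
        rw [eq_iff_iff]
        have h1 : ∀ r, QACGate.toffoliMap (Finset.univ.map .some) none
            ((Sum.elim c' fun _ => false) ∘ fun q : Option (Fin N) =>
              (q.elim (Sum.inr r) fun j => Sum.inl (j, r) : (Fin N × Fin m) ⊕ Fin m)) none =
            decide (∀ j, c' (j, r) = true) := by
          intro r
          rw [QACGate.toffoliMap_target (b := decide (∀ j, c' (j, r) = true)) (by simp)]
          simp
        constructor
        · intro h
          funext q
          rcases q with ⟨j, r⟩ | r
          · have := congrFun (h r) (some j)
            rwa [QACGate.toffoliMap_of_ne (by simp)] at this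
          · exact (congrFun (h r) none).trans (h1 r)
        · rintro rfl r
          funext q
          cases q with
          | none => exact (h1 r).symm
          | some j => rw [QACGate.toffoliMap_of_ne (by simp)]; rfl
      · rintro (⟨j, r⟩ | r) h
        · exact absurd rfl (h r (some j))
        · exact absurd rfl (h r none)
    -- Only one intermediate state contributes: the same grid contents `c`, with all conjunction
    -- qubits still 0.
    rw [seq_apply, apply_eq_sum, ← (Equiv.sumArrowEquivProdArrow _ _ Bool).symm.sum_comp,
      Fintype.sum_prod_type, Finset.sum_eq_single c, Finset.sum_eq_single fun _ => false]
    · change E.apply _ (Sum.elim c fun _ => false) *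
        F.apply (basisState (Sum.elim c fun _ => false)) _ = _
      rw [hF, basisState_self, mul_one, e3, if_pos, mul_one]
      · rfl
      · rintro (⟨j, r⟩ | r) h
        · exact absurd rfl (h j r)
        · rfl
    · intro u _ hu
      change E.apply _ (Sum.elim c u) * _ = 0
      rw [e3, if_neg, mul_zero, zero_mul]
      intro h
      refine hu (funext fun r => ?_)
      exact h (Sum.inr r) (by simp)
    · simp
    · intro c' _ hc'
      refine Finset.sum_eq_zero fun u _ => ?_
      change E.apply _ (Sum.elim c' u) * F.apply (basisState (Sum.elim c' u)) _ = 0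
      by_cases hu : u = fun _ => false
      · subst hu
        rw [hF, basisState_ne, mul_zero]
        intro h
        refine hc' (funext fun q => ?_)
        exact (congrFun h (Sum.inl q)).symm
      · rw [e3, if_neg, mul_zero, zero_mul]
        intro h
        refine hu (funext fun r => ?_)
        exact h (Sum.inr r) (by simp)
    · simp

end QACCircuit

-- With `ε = 2^(-m)` and `K = 2^(m²)`, a column is `1^m` with probability at least `1 - 4/K` and
-- `0^m` with probability at least `2/K`. The choice `N = 3K/16` balances the two events: all
-- columns `1^m` has probability at least `1 - 4N/K = 1/4`, and some column `0^m` at least `1 -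
-- exp(-3/8) ≥ 3/11`. The depth is `3 * 7 + 18 = 39`.
open QACCircuit in
theorem copySpec_fin {m N : ℕ} (hm : 2 ≤ m) (hN : 16 * N = 3 * 2 ^ (m ^ 2)) :
    CopySpec (Fin m) 39 (12 * N * m + 9 * N + 10 * m + 100) := by
  have hε : (1 / 2 ^ m : ℝ) ≤ 1 := by
    rw [div_le_one (by positivity)]
    exact one_le_pow₀ (by norm_num)
  obtain ⟨D, d1, d2, d3, d4⟩ := exists_column (by omega : 0 < m) (ε := 1 / 2 ^ m) (by positivity) hε
  obtain ⟨A, a1, a2, a3⟩ := exists_grid (N := N) D d1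
  have hpow : ((1 / 2 ^ m : ℝ)) ^ m = 1 / 2 ^ (m ^ 2) := by
    rw [div_pow, one_pow, ← pow_mul, sq]
  have hNR : (16 : ℝ) * N = 3 * 2 ^ (m ^ 2) := by exact_mod_cast hN
  have hD : (16 : ℝ) ≤ 2 ^ (m ^ 2) := by
    calc (16 : ℝ) = 2 ^ 4 := by norm_num
      _ ≤ _ := pow_le_pow_right₀ (by norm_num) (by nlinarith)
  rw [hpow] at d3 d4
  set K : ℝ := 2 ^ (m ^ 2) with hK
  have hKN : (N : ℝ) / K = 3 / 16 := by
    rw [div_eq_iff (by linarith)]; linarith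
  set p : (Fin m → Bool) → ℝ := fun w => ‖D.apply (basisState fun _ => false) w‖ ^ 2 with hp
  have hp0 : ∀ w, 0 ≤ p w := fun w => by positivity
  have hp1 : ∑ w, p w = 1 := D.sum_norm_sq_apply_basisState _
  -- the probability of an event is bounded below by a sum over the contents of the grid
  have hsum : ∀ β : Bool, (∑ c : Fin N → Fin m → Bool,
      if ∀ r, decide (∀ j, c j r = true) = β then ∏ j, p (c j) else 0) ≤
      ∑ y : (Fin N × Fin m) ⊕ Fin m → Bool, if ∀ r, y (Sum.inr r) = β then
        ‖A.apply (basisState fun _ => false) y‖ ^ 2 else 0 := by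
    intro β
    let τ : (Fin N → Fin m → Bool) ↪ ((Fin N × Fin m) ⊕ Fin m → Bool) :=
      ⟨fun c => Sum.elim (fun q => c q.1 q.2) fun r => decide (∀ j, c j r = true), fun c c' h =>
        funext fun j => funext fun r => congrFun h (Sum.inl (j, r))⟩
    calc _ = ∑ c, (if ∀ r, τ c (Sum.inr r) = β then
          ‖A.apply (basisState fun _ => false) (τ c)‖ ^ 2 else 0) := by
          refine Finset.sum_congr rfl fun c _ => ?_
          have := a3 fun q => c q.1 q.2
          have h2 : A.apply (basisState fun _ => false) (τ c) =
            ∏ j, D.apply (basisState fun _ => false) (c j) := this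
          rw [h2, norm_prod, ← Finset.prod_pow]
          rfl
      _ = ∑ y ∈ Finset.univ.map τ, (if ∀ r, y (Sum.inr r) = β then
          ‖A.apply (basisState fun _ => false) y‖ ^ 2 else 0) := by rw [Finset.sum_map]
      _ ≤ _ := Finset.sum_le_univ_sum_of_nonneg fun y => by positivity
  have hA : ∀ β : Bool, 1 / 4 ≤ ∑ y : (Fin N × Fin m) ⊕ Fin m → Bool,
      if ∀ r, y (Sum.inr r) = β then ‖A.apply (basisState fun _ => false) y‖ ^ 2 else 0 := by
    intro β
    refine le_trans ?_ (hsum β)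
    cases β
    · have hlow : 2 / K ≤ p fun _ => false := by
        rw [hp]
        simp only [d4]
        -- Bernoulli's inequality, with `m / 2^m ≤ 1/2`, bounds the factor `(1 - ε)^m` below by 1/2.
        have h1 : 1 + (m : ℝ) * (-(1 / 2 ^ m)) ≤ (1 + -(1 / 2 ^ m)) ^ m :=
          one_add_mul_le_pow (by linarith) m
        have h2 : (m : ℝ) * (1 / 2 ^ m) ≤ 1 / 2 := by
          obtain ⟨k, rfl⟩ : ∃ k, m = k + 1 := ⟨m - 1, by omega⟩
          have h3 : ((k + 1 : ℕ) : ℝ) ≤ 2 ^ k := by exact_mod_cast Nat.lt_two_pow_self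
          rw [mul_one_div, div_le_div_iff₀ (by positivity) (by norm_num), pow_succ]
          linarith
        have h4 : 1 / 2 ≤ (1 - 1 / 2 ^ m : ℝ) ^ m := by
          rw [← sub_eq_add_neg] at h1; linarith
        calc 2 / K = 4 * (1 / K) * (1 / 2) := by ring
          _ ≤ _ := by gcongr
      have hle1 : p (fun _ => false) ≤ 1 := by
        rw [← hp1]
        exact Finset.single_le_sum (fun w _ => hp0 w) (Finset.mem_univ _)
      have hmiss : (1 - p fun _ => false) ^ N ≤ 8 / 11 := by
        have h1 : (1 - p fun _ => false) ≤ Real.exp (-(2 / K)) :=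
          le_trans (by linarith) (Real.add_one_le_exp (-(2 / K)))
        have h2 : Real.exp (3 / 8) ≥ 11 / 8 := le_trans (by norm_num) (Real.add_one_le_exp (3 / 8))
        calc (1 - p fun _ => false) ^ N ≤ Real.exp (-(2 / K)) ^ N :=
              pow_le_pow_left₀ (by linarith) h1 N
          _ = (Real.exp (3 / 8))⁻¹ := by
              rw [← Real.exp_nat_mul, ← Real.exp_neg]
              congr 1
              linear_combination (-2) * hKN
          _ ≤ (11 / 8)⁻¹ := inv_anti₀ (by norm_num) h2
          _ = _ := by norm_num
      have hone : ∑ c : Fin N → Fin m → Bool, ∏ j, p (c j) = 1 := by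
        rw [← Fintype.sum_pow, hp1, one_pow]
      have hnone : ∑ c : Fin N → Fin m → Bool, ∏ j, (if c j = fun _ => false then 0 else p (c j)) =
          (1 - p fun _ => false) ^ N := by
        have := Fintype.sum_pow (fun w => if w = fun _ => false then 0 else p w) N
        rw [← this]
        congr 1
        rw [← hp1, ← Finset.add_sum_erase _ _ (Finset.mem_univ fun _ : Fin m => false),
          ← Finset.add_sum_erase _ p (Finset.mem_univ fun _ : Fin m => false)]
        simp only [if_true, zero_add, add_sub_cancel_left]
        exact Finset.sum_congr rfl fun w hw => if_neg (Finset.ne_of_mem_erase hw)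
      -- The difference of products is the probability of `c` when `c` has a zero column, and 0
      -- otherwise; one zero column makes every row conjunction false.
      have : ∑ c : Fin N → Fin m → Bool, (∏ j, p (c j) -
          ∏ j, (if c j = fun _ => false then 0 else p (c j))) ≤ ∑ c : Fin N → Fin m → Bool,
          if ∀ r, decide (∀ j, c j r = true) = false then ∏ j, p (c j) else 0 := by
        refine Finset.sum_le_sum fun c _ => ?_
        by_cases hc : ∃ j, c j = fun _ => false
        · obtain ⟨j, hj⟩ := hc
          have hz : ∏ j, (if c j = fun _ => false then 0 else p (c j)) = 0 :=
            Finset.prod_eq_zero (Finset.mem_univ j) (if_pos hj)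
          rw [if_pos, hz, sub_zero]
          intro r
          rw [decide_eq_false_iff_not]
          intro h
          simpa [hj] using h j
        · push Not at hc
          simp only [hc, if_false, sub_self]
          split_ifs
          · exact Finset.prod_nonneg fun j _ => hp0 _
          · exact le_rfl
      rw [Finset.sum_sub_distrib, hone, hnone] at this
      linarith
    · have h1 : p (fun _ => true) ^ N ≤ ∑ c : Fin N → Fin m → Bool,
          if ∀ r, decide (∀ j, c j r = true) = true then ∏ j, p (c j) else 0 := by
        have := Finset.single_le_sum (f := fun c : Fin N → Fin m → Bool =>
          if ∀ r, decide (∀ j, c j r = true) = true then ∏ j, p (c j) else 0) (s := Finset.univ)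
          (fun c _ => by
            split_ifs
            · exact Finset.prod_nonneg fun j _ => hp0 _
            · exact le_rfl) (Finset.mem_univ fun _ _ => true)
        simpa using this
      refine le_trans ?_ h1
      have h2 : 1 - 4 / K ≤ p fun _ => true := by
        rw [hp]
        simp only [d3]
        nlinarith [sq_nonneg (1 / K), (by ring : 4 / K = 4 * (1 / K))]
      have h3 : 4 / K ≤ 1 := by rw [div_le_one (by linarith)]; linarith
      have h4 : 1 + (N : ℝ) * (-(4 / K)) ≤ (1 + -(4 / K)) ^ N :=
        one_add_mul_le_pow (by linarith) N
      have h5 : (1 + -(4 / K)) ^ N ≤ p (fun _ => true) ^ N :=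
        pow_le_pow_left₀ (by linarith) (by linarith) N
      have h6 : (N : ℝ) * (4 / K) = 3 / 4 := by linear_combination 4 * hKN
      linarith
  obtain ⟨B, i1, i2, out, C, c1, c2, c3⟩ := copySpec_of_prob ⟨Sum.inr, Sum.inr_injective⟩ A
    fun β => (hA β).trans_eq (Finset.sum_congr rfl fun y _ => by congr)
  refine ⟨B, i1, i2, out, C, by omega, ?_, c3⟩
  refine c2.trans ?_
  rw [a2, d2]
  simp only [Fintype.card_fin, Fintype.card_sum, Fintype.card_prod]
  exact le_of_eq (by ring)

/-! ### Iterated copying: polylogarithmic fan-out in constant depth. -/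

namespace QACCircuit

theorem Reaches.eq_of_apply_eq {Q : Type} [Fintype Q] [DecidableEq Q] {C : QACCircuit Q}
    {z w y : Q → Bool} (h : C.Reaches z y) (hC : C.apply (basisState z) = basisState w) : y = w := by
  by_contra hn
  exact h (by rw [hC, basisState_ne hn])

end QACCircuit

open QACCircuit

namespace CopySpec

theorem of_embedding {M M' : Type} {d s : ℕ} (h : CopySpec M d s) (g : M' ↪ M) :
    CopySpec M' d s := by
  obtain ⟨A, i1, i2, out, C, h1, h2, h3⟩ := h
  exact ⟨A, i1, i2, g.trans out, C, h1, h2, fun b y hy => ⟨(h3 b y hy).1, fun r => (h3 b y hy).2 _⟩⟩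

theorem mono {M : Type} {d s d' s' : ℕ} (h : CopySpec M d s) (hd : d ≤ d') (hs : s ≤ s') :
    CopySpec M d' s' := by
  obtain ⟨A, i1, i2, out, C, h1, h2, h3⟩ := h
  exact ⟨A, i1, i2, out, C, h1.trans hd, h2.trans hs, h3⟩

theorem unit : CopySpec Unit 1 2 := by
  refine ⟨Unit, inferInstance, inferInstance, .refl _,
    ofGate (.toffoli {none} (some ()) (by simp)), le_rfl, le_rfl, fun b y hy => ?_⟩
  have := hy.eq_of_apply_eq (toffoli_apply_basisState _ _)
  subst this
  refine ⟨QACGate.toffoliMap_of_ne (by simp) _, fun r => ?_⟩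
  exact (QACGate.toffoliMap_target (b := b) (by simp)).trans (by simp)

/-- Each of the `M` copies serves as the input of its own second-stage copier. The first-stage
garbage is never touched again, so it may stay entangled. -/
theorem prod {M M' : Type} [Fintype M] [DecidableEq M] {d s d' s' : ℕ} (h : CopySpec M d s)
    (h' : CopySpec M' d' s') : CopySpec (M × M') (d + d') (s + Fintype.card M * s') := by
  obtain ⟨A, i1, i2, out, C, h1, h2, h3⟩ := h
  obtain ⟨A', i1', i2', out', C', h1', h2', h3'⟩ := h'
  obtain ⟨E, e1, e2, e3⟩ := exists_family_reaches (Q := Option (A ⊕ M × A'))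
    (G := fun _ : M => Option A')
    (fun r q => q.elim (some (Sum.inl (out r))) fun a => some (Sum.inr (r, a)))
    (fun r => by rintro (_ | i) (_ | j) <;> simp)
    (fun i j => by rintro (_ | a) (_ | b) <;> (simp; try tauto)) (fun _ => C') (fun _ => h1')
  refine ⟨A ⊕ M × A', inferInstance, inferInstance,
    ⟨fun p => Sum.inr (p.1, out' p.2), fun p p' h => by
      simpa [Prod.ext_iff] using h⟩,
    (C.map (Function.Embedding.optionMap ⟨Sum.inl, Sum.inl_injective⟩)).seq E, ?_, ?_, ?_⟩
  · rw [depth_seq, depth_map]; omega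
  · have : Fintype.card M * (C'.gateCount + Fintype.card A') ≤ Fintype.card M * s' := by gcongr
    rw [gateCount_seq, gateCount_map, e2]
    simp only [Finset.sum_const, Finset.card_univ, smul_eq_mul, Fintype.card_sum,
      Fintype.card_prod]
    rw [mul_add] at this
    omega
  · intro b y hy
    obtain ⟨w, hw, hy⟩ := hy.seq
    obtain ⟨hw, hw'⟩ := hw.map
    obtain ⟨hy, hy'⟩ := e3 _ _ hy
    have hz : ((fun q : Option (A ⊕ M × A') => q.elim b fun _ => false) ∘
        (Function.Embedding.optionMap ⟨Sum.inl, Sum.inl_injective⟩ : Option A ↪ _)) =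
        fun q => q.elim b fun _ => false := by
      funext q; cases q <;> rfl
    rw [hz] at hw
    obtain ⟨hb, hr⟩ := h3 b _ hw
    have key : ∀ r, w ∘ (fun q : Option A' => (q.elim (some (Sum.inl (out r))) fun a =>
        some (Sum.inr (r, a)) : Option (A ⊕ M × A'))) = fun q => q.elim b fun _ => false := by
      intro r
      funext q
      cases q with
      | none => exact hr r
      | some a =>
        refine hw' _ ?_
        rintro ⟨_ | q, hq⟩
        · exact Option.some_ne_none _ hq.symm
        · exact Sum.inl_ne_inr (Option.some_injective _ hq)
    refine ⟨?_, fun p => ?_⟩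
    · rw [hy' none]
      · exact hb
      · rintro i (_ | a) <;> simp
    · have h4 := hy p.1
      rw [key] at h4
      exact (h3' b _ h4).2 p.2

theorem fin_pow {m d s : ℕ} (h : CopySpec (Fin m) d s) (t : ℕ) :
    CopySpec (Fin (m ^ t)) (d * t + 1) ((m + 1) ^ t * (s + 2)) := by
  induction t with
  | zero =>
    exact (unit.mono (by omega) (by simp)).of_embedding
      ⟨fun _ => (), fun a b _ => by
        have ha : (a : ℕ) < 1 := a.2
        have hb : (b : ℕ) < 1 := b.2
        ext; omega⟩
  | succ t ih =>
    refine ((h.prod ih).of_embedding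
      ((finCongr (pow_succ' m t)).trans finProdFinEquiv.symm).toEmbedding).mono
      (by ring_nf; omega) ?_
    rw [Fintype.card_fin, pow_succ]
    have : 1 ≤ (m + 1) ^ t := Nat.one_le_pow _ _ (by omega)
    nlinarith [Nat.mul_le_mul this (le_refl (s + 2))]

theorem of_card_le {m d s t : ℕ} (h : CopySpec (Fin m) d s) {M : Type} [Fintype M]
    (hM : Fintype.card M ≤ m ^ t) : CopySpec M (d * t + 1) ((m + 1) ^ t * (s + 2)) := by
  obtain ⟨g⟩ : Nonempty (M ↪ Fin (m ^ t)) :=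
    Function.Embedding.nonempty_of_card_le (by simpa using hM)
  exact (h.fin_pow t).of_embedding g

end CopySpec

/-! ### Composing computations whose outputs are certain. -/

/-- Some circuit of depth at most `d`, with at most `s` gates and ancillas, when run on the input
`x`, gives an output bit `o` with `R x o` with certainty. -/
def Computes {ι : Type} [Fintype ι] [DecidableEq ι] (R : (ι → Bool) → Bool → Prop) (d s : ℕ) :
    Prop :=
  ∃ (B : Type) (_ : Fintype B) (_ : DecidableEq B) (out : ι ⊕ B) (C : QACCircuit (ι ⊕ B)),
    C.depth ≤ d ∧ C.gateCount + Fintype.card B ≤ s ∧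
      ∀ x y, C.Reaches (Sum.elim x fun _ => false) y → R x (y out)

namespace Computes

variable {ι : Type} [Fintype ι] [DecidableEq ι]

theorem mono {R R' : (ι → Bool) → Bool → Prop} {d s d' s' : ℕ} (h : Computes R d s)
    (hR : ∀ x o, R x o → R' x o) (hd : d ≤ d') (hs : s ≤ s') : Computes R' d' s' := by
  obtain ⟨B, i1, i2, out, C, h1, h2, h3⟩ := h
  exact ⟨B, i1, i2, out, C, h1.trans hd, h2.trans hs, fun x y hy => hR _ _ (h3 x y hy)⟩

theorem reindex {κ : Type} [Fintype κ] [DecidableEq κ] {R : (ι → Bool) → Bool → Prop} {d s : ℕ}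
    (h : Computes R d s) (e : ι ≃ κ) :
    Computes (fun (x : κ → Bool) o => R (fun i => x (e i)) o) d s := by
  obtain ⟨B, i1, i2, out, C, h1, h2, h3⟩ := h
  refine ⟨B, i1, i2, Sum.map e id out, C.map (e.sumCongr (.refl B)).toEmbedding, by simpa using h1,
    by simpa using h2, fun x y hy => ?_⟩
  have hy := hy.map.1
  have hz : (Sum.elim x fun _ => false) ∘ (e.sumCongr (.refl B)).toEmbedding =
      Sum.elim (fun i => x (e i)) fun _ => false := by
    funext q; cases q <;> rfl
  rw [hz] at hy
  exact h3 _ _ hy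

theorem and : Computes (fun (x : ι → Bool) o => o = true ↔ ∀ i, x i = true) 1 2 := by
  refine ⟨Unit, inferInstance, inferInstance, Sum.inr (),
    ofGate (.toffoli (Finset.univ.map ⟨Sum.inl, Sum.inl_injective⟩) (Sum.inr ()) (by simp)),
    le_rfl, le_rfl, fun x y hy => ?_⟩
  have := hy.eq_of_apply_eq (toffoli_apply_basisState _ _)
  subst this
  rw [QACGate.toffoliMap_target (b := decide (∀ i, x i = true)) (by simp)]
  simp

/-- De Morgan: the NOT layer also sets the target to 1, so the Toffoli gate leaves there the
negation of the conjunction of the negated inputs. -/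
theorem or : Computes (fun (x : ι → Bool) o => o = true ↔ ∃ i, x i = true) 2
    (Fintype.card ι + 3) := by
  obtain ⟨X, x1, x2, x3⟩ := exists_notLayer fun _ : ι ⊕ Unit => true
  refine ⟨Unit, inferInstance, inferInstance, Sum.inr (), X.seq
    (ofGate (.toffoli (Finset.univ.map ⟨Sum.inl, Sum.inl_injective⟩) (Sum.inr ()) (by simp))),
    by rw [depth_seq, depth_ofGate]; omega, by rw [gateCount_seq, x2]; simp, fun x y hy => ?_⟩
  obtain ⟨w, hw, hy⟩ := hy.seq
  have := hw.eq_of_apply_eq (x3 _)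
  subst this
  have := hy.eq_of_apply_eq (toffoli_apply_basisState _ _)
  subst this
  rw [QACGate.toffoliMap_target (b := decide (∀ i, x i = false)) (by simp)]
  simp

/-- Fan-out of the input. -/
theorem dup {M : Type} [Fintype M] [DecidableEq M] {R : (ι × M → Bool) → Bool → Prop}
    {d s d' s' : ℕ} (h : Computes R d s) (h' : CopySpec M d' s') :
    Computes (fun (x : ι → Bool) o => R (fun p => x p.1) o) (d' + d)
      (Fintype.card ι * s' + s) := by
  obtain ⟨B, i1, i2, out, C, h1, h2, h3⟩ := h
  obtain ⟨A, i1', i2', out', D, h1', h2', h3'⟩ := h'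
  obtain ⟨E, e1, e2, e3⟩ := exists_family_reaches (Q := ι ⊕ (ι × A ⊕ B))
    (G := fun _ : ι => Option A)
    (fun i q => q.elim (Sum.inl i) fun a => Sum.inr (Sum.inl (i, a)))
    (fun r => by rintro (_ | i) (_ | j) <;> simp)
    (fun i j => by rintro (_ | a) (_ | b) <;> (simp; try tauto)) (fun _ => D) (fun _ => h1')
  let f : (ι × M) ⊕ B ↪ ι ⊕ (ι × A ⊕ B) :=
    ⟨fun q => q.elim (fun p => Sum.inr (Sum.inl (p.1, out' p.2))) fun b => Sum.inr (Sum.inr b), by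
      rintro (⟨i, r⟩ | b) (⟨i', r'⟩ | b') <;> simp⟩
  refine ⟨ι × A ⊕ B, inferInstance, inferInstance, f out, E.seq (C.map f), ?_, ?_, ?_⟩
  · rw [depth_seq, depth_map]; omega
  · have : Fintype.card ι * (D.gateCount + Fintype.card A) ≤ Fintype.card ι * s' := by gcongr
    rw [gateCount_seq, gateCount_map, e2]
    simp only [Finset.sum_const, Finset.card_univ, smul_eq_mul, Fintype.card_sum,
      Fintype.card_prod]
    rw [mul_add] at this
    omega
  · intro x y hy
    obtain ⟨w, hw, hy⟩ := hy.seq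
    obtain ⟨hw, hw'⟩ := e3 _ _ hw
    have hy := hy.map.1
    have hwf : w ∘ f = Sum.elim (fun p => x p.1) fun _ => false := by
      funext q
      rcases q with ⟨i, r⟩ | b
      · have h4 := hw i
        have hz : (Sum.elim x fun _ => false) ∘ (fun q : Option A => (q.elim (Sum.inl i) fun a =>
            Sum.inr (Sum.inl (i, a)) : ι ⊕ (ι × A ⊕ B))) = fun q => q.elim (x i) fun _ => false := by
          funext q; cases q <;> rfl
        rw [hz] at h4
        exact (h3' _ _ h4).2 r
      · refine hw' (Sum.inr (Sum.inr b)) ?_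
        rintro i (_ | a) <;> simp
    rw [hwf] at hy
    exact h3 _ _ hy

/-- Read-once composition. -/
theorem comp {κ : Type} [Fintype κ] [DecidableEq κ] {η : κ → Type} [∀ k, Fintype (η k)]
    [∀ k, DecidableEq (η k)] {S : (κ → Bool) → Bool → Prop} {R : ∀ k, (η k → Bool) → Bool → Prop}
    {d s d' s' : ℕ} (h : Computes S d s) (h' : ∀ k, Computes (R k) d' s') :
    Computes (fun (x : (Σ k, η k) → Bool) o => ∃ z, (∀ k, R k (fun i => x ⟨k, i⟩) (z k)) ∧ S z o)
      (d' + d) (Fintype.card κ * s' + s) := by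
  obtain ⟨B, i1, i2, out, C, h1, h2, h3⟩ := h
  choose A i1' i2' out' D h1' h2' h3' using h'
  let g : ∀ k, η k ⊕ A k → (Σ k, η k) ⊕ ((Σ k, A k) ⊕ B) := fun k q =>
    q.elim (fun i => Sum.inl ⟨k, i⟩) fun a => Sum.inr (Sum.inl ⟨k, a⟩)
  have hg : ∀ k, Function.Injective (g k) := by
    rintro k (i | a) (i' | a') <;> simp [g]
  have hgd : ∀ k l a b, g k a = g l b → k = l := by
    rintro k l (i | a) (i' | a') <;> simp [g] <;> tauto
  obtain ⟨E, e1, e2, e3⟩ := exists_family_reaches g hg hgd D h1'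
  let f : κ ⊕ B ↪ (Σ k, η k) ⊕ ((Σ k, A k) ⊕ B) :=
    ⟨fun q => q.elim (fun k => g k (out' k)) fun b => Sum.inr (Sum.inr b), by
      have hne : ∀ k a b, g k a ≠ Sum.inr (Sum.inr b) := by
        rintro k (i | a) b <;> simp [g]
      rintro (k | b) (k' | b') hk
      · exact congrArg _ (hgd _ _ _ _ hk)
      · exact absurd hk (hne _ _ _)
      · exact absurd hk.symm (hne _ _ _)
      · simpa using hk⟩
  -- The inner output bits need not be determined by `x`, since different branches may carry
  -- different ones. The intermediate `z` is therefore read off from the branch `w`.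
  refine ⟨(Σ k, A k) ⊕ B, inferInstance, inferInstance, f out, E.seq (C.map f), ?_, ?_, ?_⟩
  · rw [depth_seq, depth_map]; omega
  · have : ∑ k, ((D k).gateCount + Fintype.card (A k)) ≤ ∑ _k : κ, s' :=
      Finset.sum_le_sum fun k _ => h2' k
    rw [gateCount_seq, gateCount_map, e2, Fintype.card_sum, Fintype.card_sigma]
    simp only [Finset.sum_add_distrib, Finset.sum_const, Finset.card_univ, smul_eq_mul] at this
    omega
  · intro x y hy
    obtain ⟨w, hw, hy⟩ := hy.seq
    obtain ⟨hw, hw'⟩ := e3 _ _ hw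
    have hy := hy.map.1
    have hwf : w ∘ f = Sum.elim (fun k => w (g k (out' k))) fun _ => false := by
      funext q
      rcases q with k | b
      · rfl
      · refine hw' (Sum.inr (Sum.inr b)) ?_
        rintro k (i | a) <;> simp [g]
    rw [hwf] at hy
    refine ⟨fun k => w (g k (out' k)), fun k => ?_, h3 _ _ hy⟩
    have h4 := hw k
    have hz : (Sum.elim x fun _ => false) ∘ g k = Sum.elim (fun i => x ⟨k, i⟩) fun _ => false := by
      funext q; cases q <;> rfl
    rw [hz] at h4
    exact h3' k _ _ h4

/-- A final Toffoli gate with one control copies the result to the designated last qubit, at the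
cost of one layer. -/
theorem exists_exactlyDecides {n : ℕ} {f : (Fin n → Bool) → Bool} {d s : ℕ}
    (h : Computes (fun (x : Fin n → Bool) o => o = f x) d s) :
    ∃ (a : ℕ) (C : QACCircuit (Reg n a)), C.depth ≤ d + 1 ∧ C.size ≤ s + n + 2 ∧
      C.ExactlyDecides f := by
  obtain ⟨B, i1, i2, out, C, h1, h2, h3⟩ := h
  let e : Fin n ⊕ B ↪ Reg n (Fintype.card B) :=
    (Function.Embedding.refl _).sumMap
      ((Fintype.equivFin B).toEmbedding.trans ⟨Sum.inl, Sum.inl_injective⟩)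
  have he : ∀ q, e q ≠ outQubit n (Fintype.card B) := by
    rintro (q | q) <;> simp [e, outQubit]
  refine ⟨Fintype.card B, (C.map e).seq (ofGate (.toffoli {e out} (outQubit n _)
    (by simpa using (he out).symm))), ?_, ?_, fun x => ?_⟩
  · rw [depth_seq, depth_map, depth_ofGate]; omega
  · rw [size_eq, gateCount_seq, gateCount_map, gateCount_ofGate]
    simp
    omega
  · rw [measureProb_eq_one, sub_zero]
    intro y hy
    obtain ⟨w, hw, hy⟩ := hy.seq
    obtain ⟨hw, hw'⟩ := hw.map
    have hz : initBits (Fintype.card B) x ∘ e = Sum.elim x fun _ => false := by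
      funext q; cases q <;> rfl
    rw [hz] at hw
    have := h3 _ _ hw
    have h4 := hy.eq_of_apply_eq (toffoli_apply_basisState _ _)
    subst h4
    have h5 : w (outQubit n _) = false := hw' _ (by rintro ⟨q, hq⟩; exact he q hq)
    rw [QACGate.toffoliMap_target (b := f x), h5, Bool.false_xor]
    simp [← this]

end Computes

/-! ### Interference tests on the Hamming weight. -/

/-- The phase gate `diag(1, u)`. -/
def phaseUnitary (u : ℂ) (hu : ‖u‖ = 1) : Matrix.unitaryGroup Bool ℂ :=
  ⟨Matrix.of fun i j => if i = j then (if i then u else 1) else 0, by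
    have h' : u * conj u = 1 := by rw [Complex.mul_conj', hu]; norm_num
    rw [Matrix.mem_unitaryGroup_iff]
    ext i j
    cases i <;> cases j <;> simp [Matrix.mul_apply, Matrix.star_apply, h']⟩

/-- The number of ones. -/
def bitCount {ι : Type} [Fintype ι] (x : ι → Bool) : ℕ :=
  (Finset.univ.filter fun i => x i = true).card

namespace QACCircuit

theorem single_apply_basisState_eq {Q : Type} [Fintype Q] [DecidableEq Q] (q : Q)
    (U : Matrix.unitaryGroup Bool ℂ) (z : Q → Bool) :
    (ofGate (.single q U)).apply (basisState z) =
      ∑ b, (U : Matrix Bool Bool ℂ) b (z q) • basisState (Function.update z q b) := by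
  funext y
  rw [ofGate_apply, QACGate.apply, Finset.sum_apply]
  simp only [Pi.smul_apply, smul_eq_mul, basisState]
  have h1 : ∀ b, Function.update y q b = z ↔ (b = z q ∧ y = Function.update z q (y q)) := by
    intro b
    constructor
    · rintro rfl; simp
    · rintro ⟨rfl, h⟩
      rw [h]; simp
  have h2 : ∀ b, y = Function.update z q b ↔ (b = y q ∧ y = Function.update z q (y q)) := by
    intro b
    constructor
    · intro h
      have : y q = b := by rw [h]; simp
      exact ⟨this.symm, by rw [this]; exact h⟩
    · rintro ⟨rfl, h⟩
      exact h
  by_cases h : y = Function.update z q (y q)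
  · have e1 : ∀ b, (Function.update y q b = z ↔ b = z q) := fun b => by rw [h1]; simp [← h]
    have e2 : ∀ b, (y = Function.update z q b ↔ b = y q) := fun b => by rw [h2]; simp [← h]
    simp [e1, e2]
  · have e1 : ∀ b, ¬ Function.update y q b = z := fun b hb => h ((h1 b).1 hb).2
    have e2 : ∀ b, ¬ y = Function.update z q b := fun b hb => h ((h2 b).1 hb).2
    simp [e1, e2]

/-- The phase `u` on the odd-parity states of two qubits. -/
theorem exists_parityPhase (u : ℂ) (hu : ‖u‖ = 1) :
    ∃ D : QACCircuit Bool, D.depth = 3 ∧ D.gateCount = 3 ∧ ∀ z, D.apply (basisState z) =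
      (if xor (z true) (z false) then u else 1) • basisState z := by
  have ht : true ∉ ({false} : Finset Bool) := by simp
  refine ⟨((ofGate (.toffoli {false} true ht)).seq (ofGate (.single true (phaseUnitary u hu)))).seq
    (ofGate (.toffoli {false} true ht)), rfl, rfl, fun z => ?_⟩
  have h1 : QACGate.toffoliMap {false} true z true = xor (z true) (z false) :=
    QACGate.toffoliMap_target (by simp)
  have h2 : QACGate.toffoliMap {false} true (QACGate.toffoliMap {false} true z) = z :=
    QACGate.involutive_toffoli ht z
  have h3 : (ofGate (.single true (phaseUnitary u hu))).apply
      (basisState (QACGate.toffoliMap {false} true z)) = (if xor (z true) (z false) then u else 1) •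
        basisState (QACGate.toffoliMap {false} true z) := by
    rw [single_apply_basisState_eq, h1]
    have h4 := Function.update_eq_self true (QACGate.toffoliMap {false} true z)
    rw [h1] at h4
    cases h : xor (z true) (z false) <;> rw [h] at h4 <;>
      simp [phaseUnitary, h4]
  rw [seq_apply, seq_apply, toffoli_apply_basisState, h3, apply_smul, toffoli_apply_basisState, h2]

theorem exists_parityPhases {ι Q : Type} [Fintype ι] [DecidableEq ι] [Fintype Q] [DecidableEq Q]
    (f : ι → Bool → Q) (hf : ∀ i, Function.Injective (f i))
    (hdis : ∀ i j a b, f i a = f j b → i = j) (u : ℂ) (hu : ‖u‖ = 1) :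
    ∃ D : QACCircuit Q, D.depth ≤ 3 ∧ D.gateCount = Fintype.card ι * 3 ∧
      ∀ z, D.apply (basisState z) =
        (∏ i, if xor (z (f i true)) (z (f i false)) then u else 1) • basisState z := by
  obtain ⟨D, d1, d2, d3⟩ := exists_parityPhase u hu
  obtain ⟨E, e1, e2, e3⟩ := exists_family f hf hdis (fun _ => D) (fun _ => d1.le)
  refine ⟨E, e1, by rw [e2]; simp [d2], fun z => ?_⟩
  funext y
  rw [e3]
  simp only [d3, Pi.smul_apply, smul_eq_mul, Finset.prod_mul_distrib, Function.comp_apply]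
  rw [mul_assoc]
  congr 1
  simp only [basisState]
  rw [Fintype.prod_ite_zero, ite_zero_mul_ite_zero]
  simp only [Finset.prod_const_one, mul_one]
  refine if_congr ⟨fun h => funext fun q => ?_, fun h => ⟨fun i => by rw [h], fun q _ => by rw [h]⟩⟩
    rfl rfl
  by_cases hq : ∃ i a, f i a = q
  · obtain ⟨i, a, rfl⟩ := hq
    exact congrFun (h.1 i) a
  · push Not at hq
    exact h.2 q hq

end QACCircuit

theorem prod_ite_bit {ι : Type} [Fintype ι] (x : ι → Bool) (u : ℂ) :
    (∏ i, if x i then u else 1) = u ^ bitCount x := by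
  simp [bitCount, Finset.prod_ite]

theorem prod_ite_not_bit {ι : Type} [Fintype ι] (x : ι → Bool) (u : ℂ) :
    (∏ i, if !x i then u else 1) * u ^ bitCount x = u ^ Fintype.card ι := by
  rw [← prod_ite_bit, ← Finset.prod_mul_distrib, ← Finset.card_univ, ← Finset.prod_const]
  refine Finset.prod_congr rfl fun i _ => ?_
  cases x i <;> simp

/-- An interference test that distinguishes the weights at which the phase
`v * u ^ (card ι - 2 * bitCount x)` is `1` and `-1`. -/
theorem computes_interference {ι : Type} [Fintype ι] [DecidableEq ι] {d s : ℕ}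
    (h : CopySpec ι d s) (u v : ℂ) (hu : ‖u‖ = 1) (hv : ‖v‖ = 1) :
    Computes (fun (x : ι → Bool) o =>
      (v * u ^ Fintype.card ι = u ^ (2 * bitCount x) → o = false) ∧
      (v * u ^ Fintype.card ι = -u ^ (2 * bitCount x) → o = true))
      (2 * d + 6) (2 * s + 3 * Fintype.card ι + 4) := by
  obtain ⟨A, i1, i2, out, C, h1, h2, h3⟩ := h
  let row : ι → Bool → ι ⊕ Option A := fun i b => if b then Sum.inr (some (out i)) else Sum.inl i
  obtain ⟨D, d1, d2, d3⟩ := exists_parityPhases row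
    (fun i => by rintro (_ | _) (_ | _) <;> simp [row])
    (fun i j => by rintro (_ | _) (_ | _) <;> simp [row]) u hu
  let e : Option A ↪ ι ⊕ Option A := ⟨Sum.inr, Sum.inr_injective⟩
  -- The control qubit is copied, each copy is paired with one input for a parity phase, and the
  -- copying is undone. Here the garbage must be erased, or the two branches of the control could
  -- not interfere.
  set V : QACCircuit (ι ⊕ Option A) := ((C.map e).seq D).seq (C.map e).inv with hV
  let c : ι ⊕ Option A := Sum.inr none
  refine ⟨Option A, inferInstance, inferInstance, c,
    (((ofGate (.single c hadamard)).seq V).seq (ofGate (.single c (phaseUnitary v hv)))).seq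
      (ofGate (.single c hadamard)), ?_, ?_, fun x y hy => ?_⟩
  · simp only [hV, depth_seq, depth_ofGate, depth_inv, depth_map]; omega
  · simp only [hV, gateCount_seq, gateCount_ofGate, gateCount_inv, gateCount_map, d2,
      Fintype.card_option]
    omega
  set z : Bool → ι ⊕ Option A → Bool := fun b => Sum.elim x fun q => q.elim b fun _ => false
    with hz
  have hup : ∀ b b', Function.update (z b) c b' = z b' := by
    intro b b'
    funext q
    rcases q with i | _ | a <;> simp [z, c]
  have hzc : ∀ b, z b c = b := fun b => rfl
  have hz0 : (Sum.elim x fun _ => false) = z false := by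
    funext q
    rcases q with i | _ | a <;> rfl
  have hVz : ∀ b, V.apply (basisState (z b)) =
      (∏ i, if xor b (x i) then u else 1) • basisState (z b) := by
    intro b
    -- Every basis state reached by the copying circuit has all copies equal to `b`, so the diagonal
    -- circuit `D` acts on the whole superposition, garbage included, as one scalar.
    have hD : D.apply ((C.map e).apply (basisState (z b))) =
        (∏ i, if xor b (x i) then u else 1) • (C.map e).apply (basisState (z b)) := by
      funext w
      rw [apply_eq_sum, Pi.smul_apply, smul_eq_mul]
      simp only [d3, Pi.smul_apply, smul_eq_mul]
      rw [Finset.sum_eq_single w]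
      · by_cases hw : (C.map e).Reaches (z b) w
        · rw [basisState_self, mul_one, mul_comm]
          congr 1
          obtain ⟨hw1, hw2⟩ := hw.map
          have := h3 b _ hw1
          refine Finset.prod_congr rfl fun i _ => ?_
          have e1 : w (row i true) = b := this.2 i
          have e2 : w (row i false) = x i := hw2 (Sum.inl i) (by simp [e])
          rw [e1, e2]
        · have : (C.map e).apply (basisState (z b)) w = 0 := by
            by_contra hn; exact hw hn
          rw [this]; ring
      · intro w' _ hw'
        rw [basisState_ne hw'.symm]; ring
      · simp
    rw [hV, seq_apply, seq_apply, hD, apply_smul, inv_apply_apply]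
  have hw1 : (∏ i, if xor false (x i) then u else 1) = u ^ bitCount x := by
    simpa using prod_ite_bit x u
  have hw2 := prod_ite_not_bit x u
  simp only [Bool.false_xor] at hw1
  have hs := inv_sqrt_two_mul_self
  have hu0 : u ≠ 0 := by
    rintro rfl; simp at hu
  set lam := ∏ i, if !x i then u else 1 with hlam
  -- With `w` the weight and `K` the number of inputs, the branches of the control carry `u^w` and
  -- `v * u^(K-w)`; the second Hadamard puts half their sum on 0 and half their difference on 1.
  have final : ((((ofGate (.single c hadamard)).seq V).seq
      (ofGate (.single c (phaseUnitary v hv)))).seq (ofGate (.single c hadamard))).apply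
      (basisState (z false)) =
      ((u ^ bitCount x + v * lam) / 2) • basisState (z false) +
      ((u ^ bitCount x - v * lam) / 2) • basisState (z true) := by
    simp only [seq_apply, single_apply_basisState_eq, hup, hzc, Fintype.sum_bool, apply_add,
      apply_smul, hVz, Bool.false_xor, Bool.true_xor, hw1, ← hlam]
    have hH : ∀ a b, (hadamard : Matrix Bool Bool ℂ) a b =
        if a && b then -((√2 : ℝ) : ℂ)⁻¹ else ((√2 : ℝ) : ℂ)⁻¹ := by
      rintro (_ | _) (_ | _) <;> simp [hadamard, symUnitary]
    have hP : ∀ a b, (phaseUnitary v hv : Matrix Bool Bool ℂ) a b =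
        if a = b then (if a then v else 1) else 0 := fun a b => rfl
    simp only [hH, hP]
    match_scalars
    · simp
      linear_combination (u ^ bitCount x - v * lam) * hs
    · simp
      linear_combination (u ^ bitCount x + v * lam) * hs
  rw [Reaches, hz0, final] at hy
  have hne : z true ≠ z false := fun h => by simpa [hzc] using congrFun h c
  have hpow : u ^ bitCount x * u ^ bitCount x = u ^ (2 * bitCount x) := by
    rw [← pow_add]; congr 1; omega
  have hu1 : u ^ bitCount x ≠ 0 := pow_ne_zero _ hu0
  constructor
  · intro hcase
    have : u ^ bitCount x - v * lam = 0 := by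
      refine mul_right_cancel₀ hu1 ?_
      linear_combination hpow - v * hw2 - hcase
    rw [this] at hy
    have : y = z false := by
      by_contra hn
      simp [basisState_ne hn] at hy
    rw [this]; rfl
  · intro hcase
    have : u ^ bitCount x + v * lam = 0 := by
      refine mul_right_cancel₀ hu1 ?_
      linear_combination hpow + v * hw2 + hcase
    rw [this] at hy
    have : y = z true := by
      by_contra hn
      simp [basisState_ne hn] at hy
    rw [this]; rfl

theorem bitCount_le {ι : Type} [Fintype ι] (x : ι → Bool) : bitCount x ≤ Fintype.card ι :=
  Finset.card_le_univ _

/-- Two weights can be distinguished exactly. -/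
theorem computes_weightTest {ι : Type} [Fintype ι] [DecidableEq ι] {d s : ℕ}
    (h : CopySpec ι d s) (j j' : ℕ) :
    Computes (fun (x : ι → Bool) o => (bitCount x = j → o = false) ∧
      (j' ≠ j → bitCount x = j' → o = true)) (2 * d + 6) (2 * s + 3 * Fintype.card ι + 4) := by
  -- Passing from weight `j` to `j'` multiplies `u^(2w)` by `exp(iπ) = -1`, and `v` is chosen to
  -- make `v * u^K = u^(2j)`. For `j' = j` division by zero gives `θ = 0`, and the second claim is
  -- void.
  set θ : ℝ := Real.pi / (2 * ((j' : ℝ) - j)) with hθ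
  set K := Fintype.card ι
  refine (computes_interference h (Complex.exp ((θ : ℝ) * Complex.I))
    (Complex.exp (((2 * j - K) * θ : ℝ) * Complex.I)) (Complex.norm_exp_ofReal_mul_I _)
    (Complex.norm_exp_ofReal_mul_I _)).mono ?_ le_rfl le_rfl
  rintro x o ⟨h0, h1⟩
  have e1 : Complex.exp (((2 * j - K) * θ : ℝ) * Complex.I) *
      Complex.exp ((θ : ℝ) * Complex.I) ^ K = Complex.exp ((θ : ℝ) * Complex.I) ^ (2 * j) := by
    rw [← Complex.exp_nat_mul, ← Complex.exp_nat_mul, ← Complex.exp_add]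
    congr 1
    push_cast
    ring
  rw [e1] at h0 h1
  refine ⟨fun hx => h0 (by rw [hx]), fun hj hx => h1 ?_⟩
  have hjj : ((j' : ℂ) - j) ≠ 0 := sub_ne_zero.2 (by exact_mod_cast hj)
  rw [hx, ← Complex.exp_nat_mul, ← Complex.exp_nat_mul]
  have : ((2 * j' : ℕ) : ℂ) * ((θ : ℝ) * Complex.I) =
      ((2 * j : ℕ) : ℂ) * ((θ : ℝ) * Complex.I) + Real.pi * Complex.I := by
    rw [hθ]
    push_cast
    field_simp
    ring
  rw [this, Complex.exp_add, Complex.exp_pi_mul_I]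
  ring

/-! ### Threshold functions from weight tests and hashing. -/

/-- A threshold function on few bits. -/
theorem computes_threshold_of_copySpec {ι : Type} [Fintype ι] [DecidableEq ι] {d s k : ℕ}
    (h : CopySpec ι d s) (h' : CopySpec (Fin k × Fin (Fintype.card ι + 1)) d s) :
    Computes (fun (x : ι → Bool) o => o = true ↔ k ≤ bitCount x) (3 * d + 9)
      (Fintype.card ι * s + k * ((Fintype.card ι + 1) * (2 * s + 3 * Fintype.card ι + 4) +
        (Fintype.card ι + 4)) + 2) := by
  set K := Fintype.card ι
  have h1 : ∀ j : Fin k, Computes (fun (x : (Σ _ : Fin (K + 1), ι) → Bool) o =>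
      ∀ w : ι → Bool, (∀ j' i, x ⟨j', i⟩ = w i) → (o = true ↔ bitCount w ≠ j))
      (2 * d + 6 + 2) ((K + 1) * (2 * s + 3 * K + 4) + (K + 4)) := by
    intro j
    -- At weight `j` all tests `j` against `j'` answer false. At another weight, the test with `j'`
    -- equal to that weight answers true, whatever the remaining tests return.
    refine (Computes.or.comp fun j' : Fin (K + 1) => computes_weightTest h j j').mono ?_ le_rfl
      (by simp [K])
    rintro x o ⟨t, ht, ho⟩ w hw
    have hw' : ∀ j', (fun i => x ⟨j', i⟩) = w := fun j' => funext (hw j')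
    simp only [hw'] at ht
    rw [ho]
    constructor
    · rintro ⟨j', hj'⟩ hb
      have := (ht j').1 hb
      simp [hj'] at this
    · intro hb
      have hlt : bitCount w < K + 1 := Nat.lt_succ_of_le (bitCount_le w)
      exact ⟨⟨_, hlt⟩, (ht ⟨_, hlt⟩).2 hb rfl⟩
  have h2 := (Computes.and (ι := Fin k)).comp h1
  have h3 := ((h2.reindex (((Equiv.sigmaCongrRight fun _ => Equiv.sigmaEquivProd _ _).trans
    (Equiv.sigmaEquivProd _ _)).trans ((Equiv.prodAssoc _ _ _).symm.trans
      (Equiv.prodComm _ _)))).dup h')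
  refine h3.mono ?_ (by omega) (by simp only [Fintype.card_fin]; exact le_of_eq (by ring))
  rintro x o ⟨t, ht, ho⟩
  rw [ho]
  have ht' : ∀ j, (t j = true ↔ bitCount x ≠ j) := fun j => ht j x fun j' i => rfl
  simp only [ht']
  constructor
  · intro hj
    by_contra hlt
    exact hj ⟨_, not_le.1 hlt⟩ rfl
  · intro hk j
    have := j.2
    omega

/-- A threshold function on many bits, from a family of hash functions. -/
theorem computes_threshold_of_hash {ι H κ : Type} [Fintype ι] [DecidableEq ι] [Fintype H]
    [DecidableEq H] [Fintype κ] [DecidableEq κ] {d s k : ℕ} (hash : H → ι → κ)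
    (hhash : ∀ S : Finset ι, S.card = k → ∃ a, Set.InjOn (hash a) S)
    (h1 : CopySpec κ d s) (h2 : CopySpec (Fin k × Fin (Fintype.card κ + 1)) d s)
    (h3 : CopySpec H d s) :
    Computes (fun (x : ι → Bool) o => o = true ↔ k ≤ bitCount x) (4 * d + 13)
      (Fintype.card ι * s + (Fintype.card H * (Fintype.card κ * (Fintype.card ι + 3) +
      (Fintype.card κ * s + k * ((Fintype.card κ + 1) * (2 * s + 3 * Fintype.card κ + 4) +
        (Fintype.card κ + 4)) + 2)) + (Fintype.card H + 3))) := by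
  have hT := computes_threshold_of_copySpec h1 h2
  have hB : ∀ a : H, Computes (fun (x : ι → Bool) o => o = true ↔
      k ≤ (Finset.univ.filter fun β => ∃ i, hash a i = β ∧ x i = true).card) (3 * d + 11)
      (Fintype.card κ * (Fintype.card ι + 3) + (Fintype.card κ * s + k * ((Fintype.card κ + 1) *
        (2 * s + 3 * Fintype.card κ + 4) + (Fintype.card κ + 4)) + 2)) := by
    intro a
    -- The fibres of a hash function partition the inputs, so the bucket ORs read each input only
    -- once; fan-out is needed only across different `a`.
    have hc := (hT.comp fun β : κ => (Computes.or (ι := {i // hash a i = β})).mono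
      (fun _ _ => id) le_rfl (by
        have := Fintype.card_subtype_le fun i => hash a i = β
        omega : _ ≤ Fintype.card ι + 3)).reindex (Equiv.sigmaFiberEquiv (hash a))
    refine hc.mono ?_ (by omega) le_rfl
    rintro x o ⟨t, ht, ho⟩
    rw [ho, bitCount]
    simp only [ht]
    simp [Equiv.sigmaFiberEquiv]
  have hO := (((Computes.or (ι := H)).comp hB).reindex
    ((Equiv.sigmaEquivProd _ _).trans (Equiv.prodComm _ _))).dup h3
  refine hO.mono ?_ (by omega) le_rfl
  rintro x o ⟨t, ht, ho⟩
  have ht' : ∀ a, (t a = true ↔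
    k ≤ (Finset.univ.filter fun β => ∃ i, hash a i = β ∧ x i = true).card) := fun a => ht a
  have himg : ∀ a, (Finset.univ.filter fun β => ∃ i, hash a i = β ∧ x i = true) =
      (Finset.univ.filter fun i => x i = true).image (hash a) := by
    intro a
    ext β
    simp [and_comm]
  simp only [ho, ht', himg]
  constructor
  · rintro ⟨a, ha⟩
    exact ha.trans Finset.card_image_le
  · intro hk
    obtain ⟨S, hS, hSk⟩ := Finset.exists_subset_card_eq hk
    obtain ⟨a, ha⟩ := hhash S hSk
    refine ⟨a, ?_⟩
    rw [← hSk, ← Finset.card_image_of_injOn ha]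
    exact Finset.card_le_card (Finset.image_subset_image hS)

/-! ### Hash families and the choice of parameters. -/

/-- Low-degree polynomials are a perfect hash family. -/
theorem exists_hash {n q ℓ k : ℕ} [Fact q.Prime] (hn : n ≤ q ^ ℓ) (hq : k * k * ℓ < q) :
    ∃ hash : ZMod q → Fin n → ZMod q, ∀ S : Finset (Fin n), S.card = k →
      ∃ a, Set.InjOn (hash a) S := by
  obtain ⟨g⟩ : Nonempty (Fin n ↪ (Fin ℓ → ZMod q)) :=
    Function.Embedding.nonempty_of_card_le (by simpa [ZMod.card] using hn)
  let P : Fin n → Polynomial (ZMod q) := fun i =>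
    ((Polynomial.degreeLTEquiv (ZMod q) ℓ).symm (g i) : Polynomial (ZMod q))
  have hP : Function.Injective P := fun i j h =>
    g.injective ((Polynomial.degreeLTEquiv (ZMod q) ℓ).symm.injective (Subtype.ext h))
  have hdeg : ∀ i, P i ∈ Polynomial.degreeLT (ZMod q) ℓ := fun i => Subtype.property _
  refine ⟨fun a i => (P i).eval a, fun S hS => ?_⟩
  -- A point `a` is bad only if it is a root of a nonzero difference `P i - P j`; there are at most
  -- `k²` pairs with at most `ℓ` roots each, and `k² * ℓ < q`.
  have hcard : (S.offDiag.biUnion fun p => (P p.1 - P p.2).roots.toFinset).card <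
      (Finset.univ : Finset (ZMod q)).card := by
    rw [Finset.card_univ, ZMod.card]
    refine lt_of_le_of_lt ((Finset.card_biUnion_le_card_mul _ _ ℓ fun p _ => ?_).trans ?_) hq
    · refine (Multiset.toFinset_card_le _).trans ((Polynomial.card_roots' _).trans ?_)
      have := Polynomial.mem_degreeLT.1 (Submodule.sub_mem _ (hdeg p.1) (hdeg p.2))
      exact Polynomial.natDegree_le_of_degree_le this.le
    · rw [Finset.offDiag_card, hS]
      exact Nat.mul_le_mul_right _ (Nat.sub_le _ _)
  obtain ⟨a, -, ha⟩ := Finset.exists_mem_notMem_of_card_lt_card hcard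
  refine ⟨a, fun i hi j hj hij => ?_⟩
  by_contra hne
  refine ha (Finset.mem_biUnion.2 ⟨(i, j), Finset.mem_offDiag.2 ⟨hi, hj, hne⟩, ?_⟩)
  rw [Multiset.mem_toFinset, Polynomial.mem_roots (sub_ne_zero.2 fun h => hne (hP h))]
  simpa [Polynomial.IsRoot, sub_eq_zero] using hij

/-- A number of copies for which the copying circuit has polynomial size. -/
def copyArity (n : ℕ) : ℕ := Nat.sqrt (Nat.log 2 (n + 2)) + 2

theorem two_le_copyArity (n : ℕ) : 2 ≤ copyArity n := Nat.le_add_left _ _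

theorem log_succ_le_copyArity_sq (n : ℕ) : Nat.log 2 (n + 2) + 1 ≤ copyArity n ^ 2 := by
  have := Nat.lt_succ_sqrt (Nat.log 2 (n + 2))
  rw [copyArity]
  simp only [Nat.succ_eq_add_one] at this
  nlinarith

theorem copyArity_succ_le (n : ℕ) : copyArity n + 1 ≤ (n + 2) ^ 2 := by
  have h1 := Nat.sqrt_le_self (Nat.log 2 (n + 2))
  have h2 := Nat.log_lt_self 2 (by omega : n + 2 ≠ 0)
  rw [copyArity]
  nlinarith

theorem two_pow_copyArity_sq_le (n : ℕ) : 2 ^ copyArity n ^ 2 ≤ (n + 2) ^ 10 := by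
  have h1 : copyArity n ^ 2 ≤ 2 * Nat.log 2 (n + 2) + 8 := by
    have := Nat.sqrt_le' (Nat.log 2 (n + 2))
    rw [copyArity]
    zify at this ⊢
    nlinarith [sq_nonneg ((Nat.sqrt (Nat.log 2 (n + 2)) : ℤ) - 2)]
  have h2 : 2 ^ Nat.log 2 (n + 2) ≤ n + 2 := Nat.pow_log_le_self 2 (by omega)
  calc 2 ^ copyArity n ^ 2 ≤ 2 ^ (2 * Nat.log 2 (n + 2) + 8) := Nat.pow_le_pow_right (by omega) h1
    _ = (2 ^ Nat.log 2 (n + 2)) ^ 2 * 2 ^ 8 := by rw [pow_add, mul_comm 2, pow_mul]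
    _ ≤ (n + 2) ^ 2 * (n + 2) ^ 8 := by gcongr; omega
    _ = _ := by ring

theorem IsPolylog.exists_le_copyArity_pow {k : ℕ → ℕ} (hk : IsPolylog k) :
    ∃ c, ∀ n, k n ≤ copyArity n ^ c := by
  obtain ⟨c, hc⟩ := hk
  obtain ⟨C, hC⟩ := hc.bound
  obtain ⟨n0, hn0⟩ := Filter.eventually_atTop.1 hC
  obtain ⟨C', hC'⟩ := exists_nat_ge C
  set T := ∑ i ∈ Finset.range n0, k i with hT
  -- `C'` absorbs the multiplicative constant, `2 * c` comes from `log n ≤ copyArity n ^ 2`, and `T`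
  -- covers the finitely many small `n`. Since `copyArity n ≥ 2`, the constants `C'` and `T` are
  -- bounded by its powers.
  refine ⟨C' + 2 * c + T, fun n => ?_⟩
  have h2 := two_le_copyArity n
  have hbig : ∀ a : ℕ, a ≤ copyArity n ^ a := fun a =>
    (Nat.lt_pow_self (by omega : 1 < copyArity n)).le
  by_cases hn : n < n0
  · calc k n ≤ T := Finset.single_le_sum (f := k) (fun _ _ => Nat.zero_le _) (Finset.mem_range.2 hn)
      _ ≤ copyArity n ^ T := hbig T
      _ ≤ _ := Nat.pow_le_pow_right (by omega) (by omega)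
  · have h3 := hn0 n (not_lt.1 hn)
    have hlog0 : 0 ≤ Real.log n := Real.log_natCast_nonneg n
    have hlog : Real.log n ≤ (copyArity n : ℝ) ^ 2 := by
      have h4 : (Nat.log 2 (n + 2) + 1 : ℕ) ≤ (copyArity n : ℝ) ^ 2 := by
        exact_mod_cast log_succ_le_copyArity_sq n
      refine le_trans ?_ h4
      rcases Nat.eq_zero_or_pos n with rfl | hpos
      · simp; positivity
      have h5 : (n : ℝ) ≤ 2 ^ (Nat.log 2 (n + 2) + 1) := by
        have := Nat.lt_pow_succ_log_self (b := 2) (by omega) (n + 2)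
        exact_mod_cast (by omega : n ≤ 2 ^ (Nat.log 2 (n + 2) + 1))
      calc Real.log n ≤ Real.log (2 ^ (Nat.log 2 (n + 2) + 1)) :=
            Real.log_le_log (by exact_mod_cast hpos) h5
        _ = (Nat.log 2 (n + 2) + 1 : ℕ) * Real.log 2 := Real.log_pow _ _
        _ ≤ (Nat.log 2 (n + 2) + 1 : ℕ) * 1 := by
            gcongr
            exact (Real.log_two_lt_d9.trans (by norm_num)).le
        _ = _ := mul_one _
    have h6 : (k n : ℝ) ≤ (copyArity n : ℝ) ^ (C' + 2 * c + T) := by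
      rw [Real.norm_natCast, Real.norm_of_nonneg (by positivity)] at h3
      calc (k n : ℝ) ≤ C * Real.log n ^ c := h3
        _ ≤ C' * ((copyArity n : ℝ) ^ 2) ^ c := by gcongr
        _ ≤ (copyArity n : ℝ) ^ C' * ((copyArity n : ℝ) ^ 2) ^ c := by
            gcongr
            exact_mod_cast hbig C'
        _ = (copyArity n : ℝ) ^ (C' + 2 * c) := by rw [← pow_mul, ← pow_add]
        _ ≤ _ := pow_le_pow_right₀ (by exact_mod_cast (by omega : 1 ≤ copyArity n)) (by omega)
    exact_mod_cast h6

theorem copySpec_copyArity (n : ℕ) : CopySpec (Fin (copyArity n)) 39 ((n + 2) ^ 20 - 2) := by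
  set m := copyArity n
  have hm : 2 ≤ m := two_le_copyArity n
  have h1 : m + 1 ≤ (n + 2) ^ 2 := copyArity_succ_le n
  obtain ⟨r, hr⟩ : ∃ r, m ^ 2 = r + 4 :=
    ⟨m ^ 2 - 4, (Nat.sub_add_cancel (by nlinarith : 4 ≤ m ^ 2)).symm⟩
  have hN : 3 * 2 ^ r ≤ (n + 2) ^ 10 := by
    have := two_pow_copyArity_sq_le n
    change 2 ^ m ^ 2 ≤ _ at this
    rw [hr, pow_add] at this
    omega
  -- As `m ≥ 2`, the number `2^(m²)` is divisible by 16, so the required `N = 3 * 2^(m²) / 16` is an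
  -- integer.
  refine (copySpec_fin (N := 3 * 2 ^ r) hm (by rw [hr, pow_add]; ring)).mono le_rfl ?_
  refine Nat.le_sub_of_add_le ?_
  generalize 3 * 2 ^ r = N at hN
  set W := n + 2
  have hW : 2 ≤ W := by omega
  calc 12 * N * m + 9 * N + 10 * m + 100 + 2
      ≤ 12 * W ^ 10 * W ^ 2 + 9 * (W ^ 10 * 1) + 10 * (1 * W ^ 2) + 102 * (1 * 1) := by
        have : m ≤ W ^ 2 := by omega
        have : 12 * N * m ≤ 12 * W ^ 10 * W ^ 2 := by gcongr
        omega
    _ ≤ 12 * W ^ 10 * W ^ 2 + 9 * (W ^ 10 * W ^ 2) + 10 * (W ^ 10 * W ^ 2)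
          + 102 * (W ^ 10 * W ^ 2) := by
        have : 1 ≤ W ^ 2 := Nat.one_le_pow _ _ (by omega)
        have : 1 ≤ W ^ 10 := Nat.one_le_pow _ _ (by omega)
        gcongr
    _ ≤ 2 ^ 8 * W ^ 12 := by ring_nf; omega
    _ ≤ W ^ 8 * W ^ 12 := by gcongr
    _ = W ^ 20 := by ring

theorem threshold_size_le {n q k s Z : ℕ} (hZ : 16 ≤ Z) (hn : n + 2 ≤ Z) (hq : q ≤ Z) (hk : k ≤ Z)
    (hs : s ≤ Z) :
    n * s + (q * (q * (n + 3) + (q * s + k * ((q + 1) * (2 * s + 3 * q + 4) + (q + 4)) + 2)) +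
      (q + 3)) + n + 2 ≤ Z ^ 7 := by
  have hn' : n ≤ Z := by omega
  calc n * s + (q * (q * (n + 3) + (q * s + k * ((q + 1) * (2 * s + 3 * q + 4) + (q + 4)) + 2)) +
      (q + 3)) + n + 2
    ≤ Z * Z + (Z * (Z * (Z + 3) + (Z * Z + Z * ((Z + 1) * (2 * Z + 3 * Z + 4) + (Z + 4)) + 2)) +
      (Z + 3)) + Z + 2 := by gcongr
    _ ≤ 16 * Z ^ 4 := by 
        nlinarith [Nat.mul_le_mul_right (Z ^ 3) hZ, Nat.mul_le_mul_right (Z ^ 2) hZ,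
          Nat.mul_le_mul_right Z hZ]
    _ ≤ Z * Z ^ 4 := by gcongr
    _ = Z ^ 5 := by ring
    _ ≤ Z ^ 7 := Nat.pow_le_pow_right (by omega) (by omega)

theorem exists_hash_parameters {n k c : ℕ} (hk : k ≤ copyArity n ^ c) :
    ∃ q, q.Prime ∧ n ≤ q ^ (Nat.log 2 (n + 2) + 1) ∧ k * k * (Nat.log 2 (n + 2) + 1) < q ∧
      q ≤ copyArity n ^ (3 * c + 5) ∧ k * (q + 1) ≤ copyArity n ^ (3 * c + 5) := by
  set m := copyArity n
  set ℓ := Nat.log 2 (n + 2) + 1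
  have hm : 2 ≤ m := two_le_copyArity n
  have hℓ : ℓ ≤ m ^ 2 := log_succ_le_copyArity_sq n
  -- Bertrand's postulate keeps `q` within a constant factor of `k² * ℓ + 1`, hence polylogarithmic.
  obtain ⟨q, hq, h1, h2⟩ := Nat.exists_prime_lt_and_le_two_mul (k * k * ℓ + 1) (by omega)
  have hX : 1 ≤ m ^ (2 * c + 2) := Nat.one_le_pow _ _ (by omega)
  have hkk : k * k * ℓ ≤ m ^ (2 * c + 2) := by
    calc k * k * ℓ ≤ m ^ c * m ^ c * m ^ 2 := by gcongr
      _ = _ := by rw [← pow_add, ← pow_add]; congr 1; omega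
  have hq4 : q + 1 ≤ m ^ (2 * c + 5) := by
    calc q + 1 ≤ 2 ^ 3 * m ^ (2 * c + 2) := by omega
      _ ≤ m ^ 3 * m ^ (2 * c + 2) := by gcongr
      _ = _ := by rw [← pow_add]; congr 1; omega
  refine ⟨q, hq, ?_, by omega, ?_, ?_⟩
  · have h3 := Nat.lt_pow_succ_log_self (b := 2) (by omega) (n + 2)
    have h4 : 2 ^ ℓ ≤ q ^ ℓ := Nat.pow_le_pow_left hq.two_le _
    exact (by omega : n ≤ n + 2).trans (h3.le.trans h4)
  · have : m ^ (2 * c + 5) ≤ m ^ (3 * c + 5) := Nat.pow_le_pow_right (by omega) (by omega)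
    omega
  · calc k * (q + 1) ≤ m ^ c * m ^ (2 * c + 5) := by gcongr
      _ = _ := by rw [← pow_add]; congr 1; omega

end

theorem lemma3p4 (k : ℕ → ℕ) (hk : IsPolylog k) :
    (fun n => threshold (k n) n) ∈ EQAC0 := by
  obtain ⟨c, hc⟩ := hk.exists_le_copyArity_pow
  set t := 3 * c + 5
  -- A copier has depth `39 * t + 1`; the threshold circuit uses four such depths plus 13 layers,
  -- and the transfer to the last qubit adds one. With `Z = (n + 2)^(2t + 20)` bounding every
  -- parameter, the size is at most `Z^7`.
  refine ⟨4 * (39 * t + 1) + 14, (Polynomial.X + 2) ^ ((2 * t + 20) * 7), fun n => ?_⟩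
  obtain ⟨q, hq, h1, h2, h3, h4⟩ := exists_hash_parameters (hc n)
  have : Fact q.Prime := ⟨hq⟩
  obtain ⟨hash, hhash⟩ := exists_hash h1 h2
  have hcopy : ∀ {M : Type} [Fintype M], Fintype.card M ≤ copyArity n ^ t →
      CopySpec M (39 * t + 1) ((copyArity n + 1) ^ t * ((n + 2) ^ 20 - 2 + 2)) :=
    fun hM => (copySpec_copyArity n).of_card_le hM
  have hW : 2 ^ 20 ≤ (n + 2) ^ 20 := Nat.pow_le_pow_left (by omega) 20
  rw [Nat.sub_add_cancel (le_trans (by norm_num) hW)] at hcopy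
  set s := (copyArity n + 1) ^ t * (n + 2) ^ 20
  have hs : s ≤ (n + 2) ^ (2 * t + 20) := by
    calc s ≤ ((n + 2) ^ 2) ^ t * (n + 2) ^ 20 := by
          exact Nat.mul_le_mul_right _ (Nat.pow_le_pow_left (copyArity_succ_le n) t)
      _ = _ := by rw [← pow_mul, ← pow_add]
  have hqc : Fintype.card (ZMod q) = q := ZMod.card q
  have hcomp := computes_threshold_of_hash hash hhash (hcopy (hqc.le.trans h3))
    (hcopy (by simpa [hqc] using h4)) (hcopy (hqc.le.trans h3))
  obtain ⟨a, C, hd, hsz, hC⟩ := (hcomp.mono (R' := fun x o => o = threshold (k n) n x)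
    (fun x o ho => by
      rw [threshold, Bool.eq_iff_iff, ho, decide_eq_true_iff]
      rfl) le_rfl le_rfl).exists_exactlyDecides
  refine ⟨a, C, hd, hsz.trans ?_, hC⟩
  have hmt : copyArity n ^ t ≤ (n + 2) ^ (2 * t + 20) := by
    calc copyArity n ^ t ≤ ((n + 2) ^ 2) ^ t :=
          Nat.pow_le_pow_left ((Nat.le_succ _).trans (copyArity_succ_le n)) t
      _ = (n + 2) ^ (2 * t) := by rw [← pow_mul]
      _ ≤ _ := Nat.pow_le_pow_right (by omega) (by omega)
  have hct : copyArity n ^ c ≤ copyArity n ^ t :=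
    Nat.pow_le_pow_right (by have := two_le_copyArity n; omega) (by omega)
  have key := threshold_size_le (n := n) (q := q) (k := k n) (s := s)
    (Z := (n + 2) ^ (2 * t + 20))
    (le_trans (by norm_num) (hW.trans (Nat.pow_le_pow_right (by omega) (by omega))))
    (Nat.le_self_pow (by omega) _) (h3.trans hmt) ((hc n).trans (hct.trans hmt)) hs
  rw [← pow_mul] at key
  simpa [hqc] using key
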